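/- For $n\ge 0$ let $S_n$ be the group of permutations of $[n]=\{1,\dots,n\}$, composed from right to left, with simple transpositions $s_a=(a,a+1)$, length function $\ell$ and Bruhat order $\le$. Let $H_n$ be the Hecke algebra of $S_n$ over $\mathbb{A}=\mathbb{Z}[v,v^{-1}]$, with standard basis $\{T_w\}_{w\in S_n}$, unit $T_1=1$, and relations $T_xT_y=T_{xy}$ if $\ell(xy)=\ell(x)+\ell(y)$ and $T_zT_s=(v^{-1}-v)T_z+T_{zs}$ if $s$ is a simple transposition with $zs<z$. Let $\overline{(\cdot)}$ be the ring involution of $H_n$ with $\overline{v}=v^{-1}$ and $\overline{T_w}=(T_{w^{-1}})^{-1}$, and let $\{C_w\}_{w\in S_n}$ be the Kazhdan–Lusztig basis, determined by $\overline{C_w}=C_w$ and $C_w\in T_w+\sum_{y<w}v\mathbb{Z}[v]\,T_y$. The left Kazhdan–Lusztig preorder $\le_L$ on $S_n$ is the preorder generated by the relations $x\le_L y$ whenever $C_y$ has nonzero coefficient in the expansion of $hC_x$ in the Kazhdan–Lusztig basis for some $h\in H_n$ (so the identity is the minimum). Let $m\le n$ and $i\in[n-m+1]$. Let $F^i_{m,n}:S_m\hookrightarrow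 S_n$ be the shift, i.e. the group monomorphism with $s_a\mapsto s_{a+i-1}$; thus $F^i_{m,n}(w)$ sends $a+i-1$ to $w(a)+i-1$ for $a\in[m]$ and fixes all other points. Let $x,p\in S_m$, and let $z\in S_n$ consecutively contain the pattern $p$ at position $i$, i.e. for all $a,b\in[m]$ one has $p(a)<p(b)$ if and only if $z(a+i-1)<z(b+i-1)$. Then: (a) $x\le_L p$ in $S_m$ if and only if $F^i_{m,n}(x)\le_L F^i_{m,n}(p)$ in $S_n$; (b) $x\le_L p$ in $S_m$ if and only if $F^i_{m,n}(x)\le_L z$ in $S_n$. -/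

import Mathlib

namespace KL

open scoped LaurentPolynomial

/-! ### The symmetric group: simple transpositions, length, Bruhat order

`S_n` is `Equiv.Perm (Fin n)`; the set `[n] = {1, …, n}` is modelled by `Fin n = {0, …, n - 1}`. -/

/-- The set of simple transpositions `s_a = (a, a+1)` of `S_n`. -/
def Sim (n : ℕ) : Set (Equiv.Perm (Fin n)) :=
  {s | ∃ a b : Fin n, (a : ℕ) + 1 = b ∧ s = Equiv.swap a b}

/-- `l` is an expression of `x`: a word in simple transpositions with product `x`. -/
def IsExpr {n : ℕ} (l : List (Equiv.Perm (Fin n))) (x : Equiv.Perm (Fin n)) : Prop :=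
  (∀ s ∈ l, s ∈ Sim n) ∧ l.prod = x

/-- The length of `x`: the minimal number of letters in an expression of `x`. -/
noncomputable def len {n : ℕ} (x : Equiv.Perm (Fin n)) : ℕ :=
  sInf {k | ∃ l, IsExpr l x ∧ l.length = k}

/-- `l` is a reduced expression of `x`. -/
def IsReduced {n : ℕ} (l : List (Equiv.Perm (Fin n))) (x : Equiv.Perm (Fin n)) : Prop :=
  IsExpr l x ∧ l.length = len x

/-- The Bruhat order: some reduced expression of `y` has a (not necessarily contiguous)
substring that is a reduced expression of `x`. -/
def BruhatLE {n : ℕ} (x y : Equiv.Perm (Fin n)) : Prop :=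
  ∃ l l' : List (Equiv.Perm (Fin n)), IsReduced l y ∧ l'.Sublist l ∧ IsReduced l' x

/-- The strict Bruhat order. -/
def BruhatLT {n : ℕ} (x y : Equiv.Perm (Fin n)) : Prop :=
  BruhatLE x y ∧ x ≠ y

/-- The right descent set. -/
def DesR {n : ℕ} (x : Equiv.Perm (Fin n)) : Set (Equiv.Perm (Fin n)) :=
  {s | s ∈ Sim n ∧ BruhatLT (x * s) x}

/-! ### The Hecke algebra -/

/-- The ring `𝔸 = ℤ[v, v⁻¹]`. -/
abbrev A : Type := ℤ[T;T⁻¹]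

/-- The variable `v`. -/
noncomputable def v : A := LaurentPolynomial.T 1

/-- The inverse `v⁻¹` of the variable. -/
noncomputable def vinv : A := LaurentPolynomial.T (-1)

/-- The defining relations of the Hecke algebra of `S_n` between generators `T_x`, `x ∈ S_n`.
The relation `T_1 = 1` identifies `T_1` with the unit of the algebra. -/
inductive HeckeRel (n : ℕ) :
    FreeAlgebra A (Equiv.Perm (Fin n)) → FreeAlgebra A (Equiv.Perm (Fin n)) → Prop
  | one : HeckeRel n (FreeAlgebra.ι A 1) 1
  | mul (x y : Equiv.Perm (Fin n)) (h : len (x * y) = len x + len y) :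
      HeckeRel n (FreeAlgebra.ι A x * FreeAlgebra.ι A y) (FreeAlgebra.ι A (x * y))
  | quad (z s : Equiv.Perm (Fin n)) (h : s ∈ DesR z) :
      HeckeRel n (FreeAlgebra.ι A z * FreeAlgebra.ι A s)
        ((vinv - v) • FreeAlgebra.ι A z + FreeAlgebra.ι A (z * s))

/-- The Hecke algebra of `S_n` over `𝔸`, by generators and relations. -/
def Hecke (n : ℕ) : Type := RingQuot (HeckeRel n)

noncomputable instance (n : ℕ) : Ring (Hecke n) := inferInstanceAs (Ring (RingQuot (HeckeRel n)))

noncomputable instance (n : ℕ) : Algebra A (Hecke n) :=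
  inferInstanceAs (Algebra A (RingQuot (HeckeRel n)))

/-- The quotient map from the free algebra on the symbols `T_x`. -/
noncomputable def Hecke.mk (n : ℕ) : FreeAlgebra A (Equiv.Perm (Fin n)) →ₐ[A] Hecke n :=
  RingQuot.mkAlgHom A (HeckeRel n)

theorem Hecke.mk_rel {n : ℕ} {a b : FreeAlgebra A (Equiv.Perm (Fin n))} (h : HeckeRel n a b) :
    Hecke.mk n a = Hecke.mk n b :=
  RingQuot.mkAlgHom_rel A h

/-- The standard basis elements `T_x`. -/
noncomputable def T {n : ℕ} (x : Equiv.Perm (Fin n)) : Hecke n :=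
  Hecke.mk n (FreeAlgebra.ι A x)

/-! ### Auxiliary facts for the construction of the bar involution -/

theorem T_one {n : ℕ} : T (1 : Equiv.Perm (Fin n)) = 1 := by
  simpa [T] using Hecke.mk_rel (HeckeRel.one (n := n))

theorem T_mul {n : ℕ} {x y : Equiv.Perm (Fin n)} (h : len (x * y) = len x + len y) :
    T x * T y = T (x * y) := by
  simpa [T] using Hecke.mk_rel (HeckeRel.mul x y h)

theorem T_quad {n : ℕ} {z s : Equiv.Perm (Fin n)} (h : s ∈ DesR z) :
    T z * T s = (vinv - v) • T z + T (z * s) := by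
  simpa only [T, map_mul, map_add, map_smul] using Hecke.mk_rel (HeckeRel.quad z s h)

theorem Sim.mul_self {n : ℕ} {s : Equiv.Perm (Fin n)} (hs : s ∈ Sim n) : s * s = 1 := by
  obtain ⟨a, b, -, rfl⟩ := hs
  simp

theorem Sim.inv {n : ℕ} {s : Equiv.Perm (Fin n)} (hs : s ∈ Sim n) : s⁻¹ = s := by
  obtain ⟨a, b, -, rfl⟩ := hs
  simp

theorem Sim.ne_one {n : ℕ} {s : Equiv.Perm (Fin n)} (hs : s ∈ Sim n) : s ≠ 1 := by
  obtain ⟨a, b, hab, rfl⟩ := hs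
  intro h
  have hb : a = b := by simpa using h
  subst hb
  omega

theorem exists_isExpr {n : ℕ} (x : Equiv.Perm (Fin n)) : ∃ l, IsExpr l x := by
  cases n with
  | zero => exact ⟨[], by simp, Subsingleton.elim _ _⟩
  | succ n =>
    have hx : x ∈ Submonoid.closure
        (Set.range fun i : Fin n => Equiv.swap i.castSucc i.succ) := by
      rw [Equiv.Perm.mclosure_swap_castSucc_succ]; trivial
    obtain ⟨l, hl, hp⟩ := Submonoid.exists_list_of_mem_closure hx
    refine ⟨l, fun s hs => ?_, hp⟩
    obtain ⟨i, rfl⟩ := hl s hs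
    exact ⟨_, _, by simp, rfl⟩

theorem len_le {n : ℕ} {l : List (Equiv.Perm (Fin n))} {x : Equiv.Perm (Fin n)}
    (h : IsExpr l x) : len x ≤ l.length :=
  Nat.sInf_le ⟨l, h, rfl⟩

theorem exists_isReduced {n : ℕ} (x : Equiv.Perm (Fin n)) : ∃ l, IsReduced l x := by
  obtain ⟨l, hl⟩ := exists_isExpr x
  obtain ⟨l', h, h'⟩ := Nat.sInf_mem (s := {k | ∃ l, IsExpr l x ∧ l.length = k}) ⟨_, l, hl, rfl⟩
  exact ⟨l', h, h'⟩

theorem len_one {n : ℕ} : len (1 : Equiv.Perm (Fin n)) = 0 :=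
  Nat.le_zero.1 (len_le (l := []) ⟨by simp, rfl⟩)

theorem eq_one_of_len {n : ℕ} {x : Equiv.Perm (Fin n)} (h : len x = 0) : x = 1 := by
  obtain ⟨l, hl, hl'⟩ := exists_isReduced x
  rw [h, List.length_eq_zero_iff] at hl'
  subst hl'
  exact hl.2.symm

theorem len_sim {n : ℕ} {s : Equiv.Perm (Fin n)} (hs : s ∈ Sim n) : len s = 1 := by
  have h1 : len s ≤ 1 := len_le (l := [s]) ⟨by simpa using hs, by simp⟩
  have h2 : len s ≠ 0 := fun h => Sim.ne_one hs (eq_one_of_len h)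
  omega

theorem len_mul_le {n : ℕ} (x y : Equiv.Perm (Fin n)) : len (x * y) ≤ len x + len y := by
  obtain ⟨l, hl, hl'⟩ := exists_isReduced x
  obtain ⟨k, hk, hk'⟩ := exists_isReduced y
  rw [← hl', ← hk', ← List.length_append]
  refine len_le ⟨fun s hs => ?_, by rw [List.prod_append, hl.2, hk.2]⟩
  rcases List.mem_append.1 hs with h | h
  exacts [hl.1 s h, hk.1 s h]

theorem len_inv_le {n : ℕ} (x : Equiv.Perm (Fin n)) : len x⁻¹ ≤ len x := by
  obtain ⟨l, hl, hl'⟩ := exists_isReduced x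
  have hmap : l.map (fun s => s⁻¹) = l := by
    conv_rhs => rw [← List.map_id l]
    exact List.map_congr_left fun s hs => Sim.inv (hl.1 s hs)
  have : IsExpr l.reverse x⁻¹ := by
    refine ⟨fun s hs => hl.1 s (List.mem_reverse.1 hs), ?_⟩
    rw [← hl.2, List.prod_inv_reverse, hmap]
  simpa [hl'] using len_le this

theorem len_inv {n : ℕ} (x : Equiv.Perm (Fin n)) : len x⁻¹ = len x :=
  le_antisymm (len_inv_le x) (by simpa using len_inv_le x⁻¹)

theorem len_lt_of_bruhatLT {n : ℕ} {x y : Equiv.Perm (Fin n)} (h : BruhatLT x y) :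
    len x < len y := by
  obtain ⟨⟨l, l', hl, hs, hl'⟩, hne⟩ := h
  rw [← hl.2, ← hl'.2]
  refine lt_of_le_of_ne hs.length_le fun he => hne ?_
  rw [← hl.1.2, ← hl'.1.2, hs.eq_of_length he]

theorem mem_desR_self {n : ℕ} {s : Equiv.Perm (Fin n)} (hs : s ∈ Sim n) : s ∈ DesR s := by
  refine ⟨hs, ⟨[s], [], ⟨⟨by simpa using hs, by simp⟩, by simp [len_sim hs]⟩, by simp,
    ⟨⟨by simp, by simp [Sim.mul_self hs]⟩, by simp [Sim.mul_self hs, len_one]⟩⟩, ?_⟩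
  rw [Sim.mul_self hs]
  exact (Sim.ne_one hs).symm

theorem T_sim_mul_self {n : ℕ} {s : Equiv.Perm (Fin n)} (hs : s ∈ Sim n) :
    T s * T s = (vinv - v) • T s + 1 := by
  rw [T_quad (mem_desR_self hs), Sim.mul_self hs, T_one]

theorem isUnit_T_sim {n : ℕ} {s : Equiv.Perm (Fin n)} (hs : s ∈ Sim n) : IsUnit (T s) := by
  have h := T_sim_mul_self hs
  refine ⟨⟨T s, T s - (vinv - v) • 1, ?_, ?_⟩, rfl⟩
  · rw [mul_sub, h, mul_smul_comm, mul_one]; abel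
  · rw [sub_mul, h, smul_mul_assoc, one_mul]; abel

theorem isUnit_T {n : ℕ} (x : Equiv.Perm (Fin n)) : IsUnit (T x) := by
  obtain ⟨l, hl⟩ := exists_isReduced x
  induction l generalizing x with
  | nil => rw [← hl.1.2, List.prod_nil, T_one]; exact isUnit_one
  | cons s l ih =>
    obtain ⟨⟨hS, hp⟩, hlen⟩ := hl
    have hs : s ∈ Sim n := hS s (by simp)
    have he : IsExpr l l.prod := ⟨fun t ht => hS t (by simp [ht]), rfl⟩
    rw [List.prod_cons] at hp
    rw [List.length_cons] at hlen
    have h1 := len_le he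
    have h2 := len_mul_le s l.prod
    rw [hp, len_sim hs] at h2
    have h3 : l.length = len l.prod := by omega
    have h4 : len (s * l.prod) = len s + len l.prod := by rw [hp, len_sim hs]; omega
    rw [← hp, ← T_mul h4]
    exact (isUnit_T_sim hs).mul (ih _ ⟨he, h3⟩)

/-- The element `(T_{x⁻¹})⁻¹` of the Hecke algebra. -/
noncomputable def barT {n : ℕ} (x : Equiv.Perm (Fin n)) : Hecke n :=
  ((isUnit_T x⁻¹).unit⁻¹ : (Hecke n)ˣ)

theorem barT_eq {n : ℕ} {x : Equiv.Perm (Fin n)} {b : Hecke n} (h : T x⁻¹ * b = 1) :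
    barT x = b := by
  rw [barT, Units.inv_eq_of_mul_eq_one_right]
  simpa using h

theorem T_mul_barT {n : ℕ} (x : Equiv.Perm (Fin n)) : T x⁻¹ * barT x = 1 :=
  (isUnit_T x⁻¹).mul_val_inv

theorem barT_one {n : ℕ} : barT (1 : Equiv.Perm (Fin n)) = 1 :=
  barT_eq (by simp [T_one])

theorem barT_mul {n : ℕ} {x y : Equiv.Perm (Fin n)} (h : len (x * y) = len x + len y) :
    barT x * barT y = barT (x * y) := by
  refine (barT_eq ?_).symm
  have h' : len (y⁻¹ * x⁻¹) = len y⁻¹ + len x⁻¹ := by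
    rw [← mul_inv_rev, len_inv, len_inv, len_inv, h, add_comm]
  rw [mul_inv_rev, ← T_mul h', mul_assoc, ← mul_assoc (T x⁻¹), T_mul_barT, one_mul, T_mul_barT]

theorem barT_sim {n : ℕ} {s : Equiv.Perm (Fin n)} (hs : s ∈ Sim n) :
    barT s = T s - (vinv - v) • 1 := by
  refine barT_eq ?_
  rw [Sim.inv hs, mul_sub, T_sim_mul_self hs, mul_smul_comm, mul_one]
  abel

theorem barT_quad {n : ℕ} {z s : Equiv.Perm (Fin n)} (h : s ∈ DesR z) :
    barT z * barT s = (v - vinv) • barT z + barT (z * s) := by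
  obtain ⟨hs, hlt⟩ := h
  have hz : z * s * s = z := by rw [mul_assoc, Sim.mul_self hs, mul_one]
  have h1 := len_lt_of_bruhatLT hlt
  have h2 := len_mul_le (z * s) s
  rw [hz, len_sim hs] at h2
  have h3 : len (z * s * s) = len (z * s) + len s := by rw [hz, len_sim hs]; omega
  have h4 := barT_mul h3
  rw [hz] at h4
  have h5 : barT s * barT s = (v - vinv) • barT s + 1 := by
    rw [barT_sim hs]
    simp only [mul_sub, sub_mul, mul_smul_comm, smul_mul_assoc, mul_one, one_mul,
      T_sim_mul_self hs, smul_sub, sub_smul]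
    abel
  conv_lhs => rw [← h4]
  rw [mul_assoc, h5, mul_add, mul_one, mul_smul_comm, h4]

/-! ### The bar involution and the Kazhdan–Lusztig basis -/

/-- The ring homomorphism from the free algebra that sends `v` to `v⁻¹` and the generator `T_x`
to `(T_{x⁻¹})⁻¹`. -/
noncomputable def barFree (n : ℕ) : FreeAlgebra A (Equiv.Perm (Fin n)) →+* Hecke n :=
  letI : Algebra A (Hecke n) :=
    ((algebraMap A (Hecke n)).comp (LaurentPolynomial.invert (R := ℤ) : A →+* A)).toAlgebra'
      fun a h => Algebra.commutes (LaurentPolynomial.invert a) h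
  (FreeAlgebra.lift A (barT (n := n)) : FreeAlgebra A (Equiv.Perm (Fin n)) →ₐ[A] Hecke n)

theorem barFree_ι {n : ℕ} (x : Equiv.Perm (Fin n)) :
    barFree n (FreeAlgebra.ι A x) = barT x := by
  let _ : Algebra A (Hecke n) :=
    ((algebraMap A (Hecke n)).comp (LaurentPolynomial.invert (R := ℤ) : A →+* A)).toAlgebra'
      fun a h => Algebra.commutes (LaurentPolynomial.invert a) h
  exact FreeAlgebra.lift_ι_apply (R := A) (barT (n := n)) x

theorem barFree_algebraMap {n : ℕ} (a : A) :
    barFree n (algebraMap A _ a) = algebraMap A (Hecke n) (LaurentPolynomial.invert a) := by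
  let _ : Algebra A (Hecke n) :=
    ((algebraMap A (Hecke n)).comp (LaurentPolynomial.invert (R := ℤ) : A →+* A)).toAlgebra'
      fun a h => Algebra.commutes (LaurentPolynomial.invert a) h
  exact AlgHom.commutes (FreeAlgebra.lift A (barT (n := n))) a

theorem barFree_rel {n : ℕ} ⦃a b : FreeAlgebra A (Equiv.Perm (Fin n))⦄ (h : HeckeRel n a b) :
    barFree n a = barFree n b := by
  cases h with
  | one => rw [barFree_ι, barT_one, map_one]
  | mul x y h => rw [map_mul, barFree_ι, barFree_ι, barFree_ι, barT_mul h]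
  | quad z s h =>
    rw [map_mul, map_add, Algebra.smul_def, map_mul, barFree_ι, barFree_ι, barFree_ι,
      barFree_algebraMap, barT_quad h, Algebra.smul_def]
    simp [v, vinv]

/-- The bar involution of the Hecke algebra: the ring homomorphism with `v ↦ v⁻¹` and
`T_x ↦ (T_{x⁻¹})⁻¹`. -/
noncomputable def bar (n : ℕ) : Hecke n →+* Hecke n :=
  (RingQuot.lift ⟨barFree n, barFree_rel⟩ : RingQuot (HeckeRel n) →+* Hecke n)

theorem bar_mk {n : ℕ} (a : FreeAlgebra A (Equiv.Perm (Fin n))) :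
    bar n (Hecke.mk n a) = barFree n a := by
  have h := RingQuot.lift_mkRingHom_apply (barFree n) barFree_rel a
  rw [← RingQuot.mkAlgHom_coe A] at h
  exact h

theorem bar_T {n : ℕ} (x : Equiv.Perm (Fin n)) : bar n (T x) = barT x := by
  rw [T, bar_mk, barFree_ι]

theorem bar_algebraMap {n : ℕ} (a : A) :
    bar n (algebraMap A _ a) = algebraMap A _ (LaurentPolynomial.invert a) := by
  rw [← AlgHom.commutes (Hecke.mk n), bar_mk, barFree_algebraMap]

/-- `c` is the Kazhdan–Lusztig element `C_x`: it is fixed by the bar involution and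
`c = T_x + ∑_{y < x} p_y T_y` with all `p_y ∈ v ℤ[v]`. -/
def IsKLElement {n : ℕ} (x : Equiv.Perm (Fin n)) (c : Hecke n) : Prop :=
  bar n c = c ∧
    ∃ p : Equiv.Perm (Fin n) → A,
      (∀ y, ∃ q : Polynomial ℤ, p y = v * Polynomial.toLaurent q) ∧
      (∀ y, ¬ BruhatLT y x → p y = 0) ∧
      c = T x + ∑ y, p y • T y

/-- `C` is the Kazhdan–Lusztig basis of the Hecke algebra. -/
def IsKLBasis {n : ℕ} (C : Module.Basis (Equiv.Perm (Fin n)) A (Hecke n)) : Prop :=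
  ∀ x, IsKLElement x (C x)

/-- The left Kazhdan–Lusztig preorder `x ≤_L y`: the preorder generated by the relations
`a ≤_L b` whenever `C_b` appears with nonzero coefficient in `h C_a` for some `h` in the Hecke
algebra, where `C` is the Kazhdan–Lusztig basis. -/
def LeftLE {n : ℕ} (x y : Equiv.Perm (Fin n)) : Prop :=
  ∃ C : Module.Basis (Equiv.Perm (Fin n)) A (Hecke n), IsKLBasis C ∧
    Relation.ReflTransGen (fun a b => ∃ h : Hecke n, C.repr (h * C a) b ≠ 0) x y

/-! ### Shifts and consecutive patterns

A position `i ∈ [n - m + 1]` is modelled by `i : Fin (n - m + 1)`, so that the letter of index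
`a + i - 1` becomes the one of index `a + i`. -/

/-- The inclusion of the window of size `m` at position `i` into `[n]`. -/
def window {m n : ℕ} (hmn : m ≤ n) (i : Fin (n - m + 1)) : Fin m ↪ Fin n where
  toFun a := ⟨a + i, by omega⟩
  inj' a b h := by
    simp only [Fin.mk.injEq] at h
    omega

/-- The shift `F^i_{m,n} : S_m → S_n`: the permutation acts on the window at position `i` and
fixes every other point. -/
noncomputable def shift {m n : ℕ} (hmn : m ≤ n) (i : Fin (n - m + 1)) :
    Equiv.Perm (Fin m) →* Equiv.Perm (Fin n) :=
  Equiv.Perm.viaEmbeddingHom (window hmn i)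

/-- `z` consecutively contains the pattern `p` at position `i`. -/
def ConsecContains {m n : ℕ} (hmn : m ≤ n) (z : Equiv.Perm (Fin n)) (p : Equiv.Perm (Fin m))
    (i : Fin (n - m + 1)) : Prop :=
  ∀ a b : Fin m, p a < p b ↔ z (window hmn i a) < z (window hmn i b)

end KL

/-! Every permutation `z` factors uniquely as `d * shift y` with `d` increasing on the window. Here
`y` is the consecutive pattern of `z`, and the lengths add (`len_mul_shift`). So besides the
standard basis, the Hecke algebra of `S_n` has the basis `mixed` of elements `T_d C_y`. Left
multiplication takes `C_y` (shifted) into the span of the `T_d' C_y'` with `y ≤_L y'`, because `T_u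
= T_d T_y''` lets the second factor act inside the small algebra (`mul_shiftHom_klBasis_mem`).

The key point is `klBasis_sub_mixed_mem`: `C_w - T_d C_y` is a `v ℤ[v]`-combination of elements
`T_d' C_y'` with `d'` shorter than `d` and `y ≤_L y'`. The bar involution is unitriangular on
`mixed` for this order, so the general construction `exists_invariant` yields invariant elements of
that shape, and uniqueness (`eq_klBasis`) identifies them with the `C_w`.

For `d = 1` nothing is lower, so the shift carries `C_x` to `C_{shift x}` and preserves `≤_L`.
Inverting the triangular relation, `C_z` has coefficient 1 in `T_d C_{shift y}`, so `shift y ≤_L z`.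
Conversely, the `T_d C_y` with `x ≤_L y` span a left ideal, and so do the `C_w` whose pattern is
above `x`: it is the same ideal, and a chain starting at `shift x` cannot leave it. The statement
about `shift p` is the case `z = shift p`.

The rest is foundation: subword property, freeness on the `T_x`, and existence and uniqueness of the
Kazhdan–Lusztig basis. -/

namespace KL

open scoped LaurentPolynomial

/-! ### Exchange and deletion -/

section Exchange

variable {n : ℕ}

theorem Sim.eq_swap_of_lt {s : Equiv.Perm (Fin n)} (hs : s ∈ Sim n) {i j : Fin n} (hij : i < j)
    (h : s j < s i) : s = Equiv.swap i j := by
  obtain ⟨a, b, hab, rfl⟩ := hs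
  simp only [Equiv.swap_apply_def] at h
  have : i = a ∧ j = b := by
    split_ifs at h <;> constructor <;> omega
  rw [this.1, this.2]

theorem mul_swap_eq (x : Equiv.Perm (Fin n)) (a b : Fin n) :
    x * Equiv.swap a b = Equiv.swap (x a) (x b) * x :=
  Equiv.mul_swap_eq_swap_mul x a b

/-- The strong exchange condition. -/
theorem exists_sublist_prod_mul_swap {a b : Fin n} (hab : a < b) (l : List (Equiv.Perm (Fin n)))
    (hl : ∀ s ∈ l, s ∈ Sim n) (h : l.prod b < l.prod a) :
    ∃ l' : List (Equiv.Perm (Fin n)), l'.Sublist l ∧ l'.length + 1 = l.length ∧ l'.prod = l.prod * Equiv.swap a b := by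
  induction l with
  | nil => exact absurd h (by simpa using hab.le)
  | cons s l ih =>
    rw [List.prod_cons] at h ⊢
    -- If the tail already inverts `a` and `b`, a letter of the tail is deleted. Otherwise `s`
    -- creates the inversion, so `s` swaps exactly these two values and is itself the letter to
    -- delete.
    rcases lt_or_ge (l.prod b) (l.prod a) with h' | h'
    · obtain ⟨l', h1, h2, h3⟩ := ih (fun t ht => hl t (by simp [ht])) h'
      exact ⟨s :: l', h1.cons_cons s, by simp [h2], by rw [List.prod_cons, h3, mul_assoc]⟩
    · have h'' : l.prod a < l.prod b :=
        lt_of_le_of_ne h' fun e => hab.ne (l.prod.injective e)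
      refine ⟨l, List.sublist_cons_self s l, rfl, ?_⟩
      have hs := hl s (by simp)
      rw [mul_assoc, mul_swap_eq, ← Sim.eq_swap_of_lt hs h'' h, ← mul_assoc, Sim.mul_self hs, one_mul]

theorem len_mul_swap_lt {x : Equiv.Perm (Fin n)} {a b : Fin n} (hab : a < b) (h : x b < x a) :
    len (x * Equiv.swap a b) < len x := by
  obtain ⟨l, ⟨hl, rfl⟩, hlen⟩ := exists_isReduced x
  obtain ⟨l', h1, h2, h3⟩ := exists_sublist_prod_mul_swap hab l hl h
  have := len_le (l := l') ⟨fun s hs => hl s (h1.subset hs), h3⟩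
  omega

theorem lt_len_mul_swap {x : Equiv.Perm (Fin n)} {a b : Fin n} (hab : a < b) (h : x a < x b) :
    len x < len (x * Equiv.swap a b) := by
  have := len_mul_swap_lt (x := x * Equiv.swap a b) hab (by simpa using h)
  rwa [mul_assoc, Equiv.swap_mul_self, mul_one] at this

theorem len_mul_swap_lt_iff {x : Equiv.Perm (Fin n)} {a b : Fin n} (hab : a < b) :
    len (x * Equiv.swap a b) < len x ↔ x b < x a := by
  refine ⟨fun h => ?_, len_mul_swap_lt hab⟩
  by_contra h'
  have := lt_len_mul_swap hab (lt_of_le_of_ne (not_lt.1 h') fun e => hab.ne (x.injective e))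
  omega

theorem len_swap_mul_lt_iff {x : Equiv.Perm (Fin n)} {a b : Fin n} (hab : a < b) :
    len (Equiv.swap a b * x) < len x ↔ x⁻¹ b < x⁻¹ a := by
  rw [← len_mul_swap_lt_iff hab, ← len_inv, ← len_inv x, mul_inv_rev, Equiv.swap_inv]

theorem len_mul_sim {x s : Equiv.Perm (Fin n)} (hs : s ∈ Sim n) :
    len (x * s) = len x + 1 ∨ len (x * s) + 1 = len x := by
  have h1 := len_mul_le x s
  have h2 := len_mul_le (x * s) s
  rw [mul_assoc, Sim.mul_self hs, mul_one, len_sim hs] at h2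
  rw [len_sim hs] at h1
  have h3 : len (x * s) ≠ len x := by
    obtain ⟨a, b, hab, rfl⟩ := hs
    have hab' : a < b := by rw [Fin.lt_def]; omega
    rcases lt_or_gt_of_ne (x.injective.ne hab'.ne) with h | h
    · exact (lt_len_mul_swap hab' h).ne'
    · exact (len_mul_swap_lt hab' h).ne
  omega

theorem IsReduced.append_sim {l : List (Equiv.Perm (Fin n))} {x s : Equiv.Perm (Fin n)}
    (hl : IsReduced l x) (hs : s ∈ Sim n) (h : len x < len (x * s)) :
    IsReduced (l ++ [s]) (x * s) := by
  refine ⟨⟨fun t ht => ?_, by simp [hl.1.2]⟩, ?_⟩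
  · rcases List.mem_append.1 ht with ht | ht
    · exact hl.1.1 t ht
    · rw [List.mem_singleton.1 ht]; exact hs
  · have := len_mul_sim (x := x) hs
    have := hl.2
    simp only [List.length_append, List.length_singleton]
    omega

theorem mem_desR_iff {x s : Equiv.Perm (Fin n)} :
    s ∈ DesR x ↔ s ∈ Sim n ∧ len (x * s) < len x := by
  refine ⟨fun h => ⟨h.1, len_lt_of_bruhatLT h.2⟩, fun ⟨hs, h⟩ => ⟨hs, ?_, ?_⟩⟩
  · obtain ⟨l, hl⟩ := exists_isReduced (x * s)
    have hx : x * s * s = x := by rw [mul_assoc, Sim.mul_self hs, mul_one]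
    have := hl.append_sim hs (by rwa [hx])
    rw [hx] at this
    exact ⟨l ++ [s], l, this, List.sublist_append_left _ _, hl⟩
  · intro e
    rw [e] at h
    exact h.false

theorem IsReduced.exists_sublist_mul_sim {l : List (Equiv.Perm (Fin n))} {x s : Equiv.Perm (Fin n)}
    (hl : IsReduced l x) (hs : s ∈ Sim n) (h : len (x * s) < len x) :
    ∃ l', l'.Sublist l ∧ IsReduced l' (x * s) := by
  have h1 : len (x * s) + 1 = len x := (len_mul_sim (x := x) hs).resolve_left (by omega)
  obtain ⟨a, b, hab, rfl⟩ := hs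
  have hab' : a < b := by rw [Fin.lt_def]; omega
  rw [len_mul_swap_lt_iff hab', ← hl.1.2] at h
  obtain ⟨l', h2, h3, h4⟩ := exists_sublist_prod_mul_swap hab' l hl.1.1 h
  have := hl.2
  exact ⟨l', h2, ⟨fun s hs => hl.1.1 s (h2.subset hs), by rw [h4, hl.1.2]⟩, by omega⟩

/-- The deletion condition. -/
theorem exists_sublist_isReduced (l : List (Equiv.Perm (Fin n))) (hl : ∀ s ∈ l, s ∈ Sim n) :
    ∃ l', l'.Sublist l ∧ IsReduced l' l.prod := by
  induction l using List.reverseRecOn with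
  | nil => exact ⟨[], List.Sublist.refl _, ⟨by simp, rfl⟩, by simp [len_one]⟩
  | append_singleton l s ih =>
    obtain ⟨l', h1, h2⟩ := ih fun t ht => hl t (by simp [ht])
    have hs : s ∈ Sim n := hl s (by simp)
    rw [List.prod_append, List.prod_singleton]
    rcases len_mul_sim (x := l.prod) hs with h | h
    · exact ⟨l' ++ [s], h1.append (List.Sublist.refl _), h2.append_sim hs (by omega)⟩
    · obtain ⟨l'', h3, h4⟩ := h2.exists_sublist_mul_sim hs (by omega)
      exact ⟨l'', (h3.trans h1).trans (List.sublist_append_left _ _), h4⟩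

theorem IsReduced.of_cons {l : List (Equiv.Perm (Fin n))} {x s : Equiv.Perm (Fin n)}
    (h : IsReduced (s :: l) x) :
    s ∈ Sim n ∧ IsReduced l l.prod ∧ x = s * l.prod ∧ len x = len l.prod + 1 := by
  obtain ⟨⟨hS, rfl⟩, hlen⟩ := h
  have hs : s ∈ Sim n := hS s (by simp)
  have he : IsExpr l l.prod := ⟨fun t ht => hS t (by simp [ht]), rfl⟩
  have h1 := len_le he
  have h2 := len_mul_le s l.prod
  rw [List.prod_cons, List.length_cons] at hlen
  rw [len_sim hs] at h2
  exact ⟨hs, ⟨he, by omega⟩, by simp, by rw [List.prod_cons]; omega⟩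

theorem exists_sim_len_lt {x : Equiv.Perm (Fin n)} (hx : x ≠ 1) :
    ∃ s ∈ Sim n, len (x * s) < len x := by
  obtain ⟨l, hl⟩ := exists_isReduced x⁻¹
  cases l with
  | nil => exact absurd (inv_eq_one.1 hl.1.2.symm) hx
  | cons s l =>
    obtain ⟨hs, h1, h2, h3⟩ := hl.of_cons
    refine ⟨s, hs, ?_⟩
    have : x * s = l.prod⁻¹ := by
      rw [← inv_inv x, h2, mul_inv_rev, Sim.inv hs, mul_assoc, Sim.mul_self hs, mul_one]
    rw [this, len_inv, ← len_inv x, h3]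
    exact Nat.lt_succ_self _

/-- If left and right multiplication by simple transpositions `s`, `t` interact in length,
then `s x = x t`. -/
theorem sim_mul_eq_mul_sim {x s t : Equiv.Perm (Fin n)} (hs : s ∈ Sim n) (ht : t ∈ Sim n)
    (h : ¬ (len (s * (x * t)) < len (x * t) ↔ len (s * x) < len x)) : s * x = x * t := by
  obtain ⟨a, b, hab, rfl⟩ := hs
  have hab' : a < b := by rw [Fin.lt_def]; omega
  rw [len_swap_mul_lt_iff hab', len_swap_mul_lt_iff hab', mul_inv_rev, Sim.inv ht,
    Equiv.Perm.mul_apply, Equiv.Perm.mul_apply] at h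
  have hne : x⁻¹ a ≠ x⁻¹ b := x⁻¹.injective.ne hab'.ne
  -- A left descent at `s` compares the positions of the values `a` and `b`. Multiplying by `t`
  -- changes the outcome only if `t` exchanges these two positions.
  have key : t = Equiv.swap (x⁻¹ a) (x⁻¹ b) := by
    rcases lt_or_gt_of_ne hne with h1 | h1
    · refine Sim.eq_swap_of_lt ht h1 ?_
      by_contra h2
      exact h ⟨fun h3 => absurd h3 h2, fun h3 => absurd h3 h1.not_gt⟩
    · rw [Equiv.swap_comm]
      refine Sim.eq_swap_of_lt ht h1 ?_
      by_contra h2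
      exact h ⟨fun _ => h1, fun _ => lt_of_le_of_ne (not_lt.1 h2) (t.injective.ne hne.symm)⟩
  rw [key, mul_swap_eq]
  simp

end Exchange

/-! ### The Bruhat order -/

section Bruhat

variable {n : ℕ}

/-- Multiplication by a transposition that increases the length. -/
def BruhatStep (x y : Equiv.Perm (Fin n)) : Prop :=
  ∃ a b, a < b ∧ x a < x b ∧ y = x * Equiv.swap a b

/-- Left multiplication by `s` keeps the two values in order unless `s` swaps exactly these values;
then the step is itself multiplication by `s`. -/
theorem BruhatStep.sim_mul {x y s : Equiv.Perm (Fin n)} (h : BruhatStep x y) (hs : s ∈ Sim n) :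
    BruhatStep (s * x) (s * y) ∨ y = s * x := by
  obtain ⟨a, b, hab, hx, rfl⟩ := h
  by_cases h' : s (x b) < s (x a)
  · right
    rw [mul_swap_eq, ← Sim.eq_swap_of_lt hs hx h']
  · left
    refine ⟨a, b, hab, ?_, (mul_assoc _ _ _).symm⟩
    exact lt_of_le_of_ne (not_lt.1 h') (s.injective.ne (x.injective.ne hab.ne))

theorem bruhatStep_sim_mul {x s : Equiv.Perm (Fin n)} (hs : s ∈ Sim n) (h : len x < len (s * x)) :
    BruhatStep x (s * x) := by
  obtain ⟨a, b, hab, rfl⟩ := hs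
  have hab' : a < b := by rw [Fin.lt_def]; omega
  have h1 := mt (len_swap_mul_lt_iff (x := x) hab').2 h.not_gt
  refine ⟨x⁻¹ a, x⁻¹ b, lt_of_le_of_ne (not_lt.1 h1) (x⁻¹.injective.ne hab'.ne), by simpa, ?_⟩
  rw [mul_swap_eq]
  simp

theorem sim_mul_of_bruhatChain {x y s : Equiv.Perm (Fin n)}
    (h : Relation.ReflTransGen BruhatStep x y) (hs : s ∈ Sim n) :
    Relation.ReflTransGen BruhatStep (s * x) y ∨
      Relation.ReflTransGen BruhatStep (s * x) (s * y) := by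
  induction h using Relation.ReflTransGen.head_induction_on with
  | refl => exact Or.inr .refl
  | head h1 h2 ih =>
    rcases h1.sim_mul hs with h3 | rfl
    · exact ih.imp (.head h3) (.head h3)
    · exact Or.inl h2

/-- Chains of transpositions do not mention expressions, so passing through them frees `BruhatLE`
from the particular reduced expression in its definition. -/
theorem bruhatChain_of_sublist {l l' : List (Equiv.Perm (Fin n))} (hl : IsReduced l l.prod)
    (h : l'.Sublist l) : Relation.ReflTransGen BruhatStep l'.prod l.prod := by
  induction h with
  | slnil => exact .refl
  | cons s h ih =>
    obtain ⟨hs, h1, h2, h3⟩ := hl.of_cons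
    rw [h2] at h3 ⊢
    exact (ih h1).tail (bruhatStep_sim_mul hs (by omega))
  | cons_cons s h ih =>
    obtain ⟨hs, h1, h2, h3⟩ := hl.of_cons
    rw [h2] at h3 ⊢
    rw [List.prod_cons]
    rcases sim_mul_of_bruhatChain (ih h1) hs with h4 | h4
    · exact h4.tail (bruhatStep_sim_mul hs (by omega))
    · exact h4

/-- The subword property: reduced expressions of smaller elements are found in every reduced
expression. -/
theorem IsReduced.exists_sublist_of_bruhatChain {x y : Equiv.Perm (Fin n)}
    (h : Relation.ReflTransGen BruhatStep x y) {l : List (Equiv.Perm (Fin n))}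
    (hl : IsReduced l y) : ∃ l', l'.Sublist l ∧ IsReduced l' x := by
  induction h using Relation.ReflTransGen.head_induction_on with
  | refl => exact ⟨l, List.Sublist.refl _, hl⟩
  | head h1 h2 ih =>
    obtain ⟨l', h3, h4⟩ := ih
    obtain ⟨a, b, hab, hx, rfl⟩ := h1
    obtain ⟨l'', h5, -, h6⟩ := exists_sublist_prod_mul_swap hab l' h4.1.1 (by
      rw [h4.1.2]; simpa using hx)
    rw [h4.1.2, mul_assoc, Equiv.swap_mul_self, mul_one] at h6
    obtain ⟨k, h7, h8⟩ := exists_sublist_isReduced l'' fun s hs => h4.1.1 s (h5.subset hs)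
    exact ⟨k, (h7.trans h5).trans h3, h6 ▸ h8⟩

theorem BruhatLE.exists_sublist {x y : Equiv.Perm (Fin n)} (h : BruhatLE x y)
    {l : List (Equiv.Perm (Fin n))} (hl : IsReduced l y) :
    ∃ l', l'.Sublist l ∧ IsReduced l' x := by
  obtain ⟨k, k', h1, h2, h3⟩ := h
  have h4 := bruhatChain_of_sublist (l := k) (by rwa [h1.1.2]) h2
  rw [h1.1.2, h3.1.2] at h4
  exact hl.exists_sublist_of_bruhatChain h4

/-- The two hypotheses may use different reduced expressions of `y`; the subword property finds `x`
inside the one that sits in the expression of `z`. -/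
theorem BruhatLT.trans {x y z : Equiv.Perm (Fin n)} (h : BruhatLT x y) (h' : BruhatLT y z) :
    BruhatLT x z := by
  refine ⟨?_, ?_⟩
  · obtain ⟨l, l', h1, h2, h3⟩ := h'.1
    obtain ⟨k, h4, h5⟩ := h.1.exists_sublist h3
    exact ⟨l, k, h1, h4.trans h2, h5⟩
  · rintro rfl
    exact absurd (len_lt_of_bruhatLT h) (len_lt_of_bruhatLT h').not_gt

end Bruhat

/-! ### Shifts and minimal coset representatives -/

section Window

variable {m n : ℕ} (hmn : m ≤ n) (i : Fin (n - m + 1))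

theorem window_lt_window {a b : Fin m} : window hmn i a < window hmn i b ↔ a < b := by
  change (a : ℕ) + i < b + i ↔ (a : ℕ) < b
  omega

theorem shift_window (x : Equiv.Perm (Fin m)) (a : Fin m) :
    shift hmn i x (window hmn i a) = window hmn i (x a) :=
  Equiv.Perm.viaEmbedding_apply x (window hmn i) a

theorem shift_injective : Function.Injective (shift hmn i) :=
  Equiv.Perm.viaEmbeddingHom_injective (window hmn i)

theorem shift_swap (a b : Fin m) :
    shift hmn i (Equiv.swap a b) = Equiv.swap (window hmn i a) (window hmn i b) := by
  ext c
  by_cases hc : c ∈ Set.range (window hmn i)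
  · obtain ⟨c, rfl⟩ := hc
    rw [shift_window, (window hmn i).injective.map_swap]
  · rw [show shift hmn i (Equiv.swap a b) c = c from
      Equiv.Perm.viaEmbedding_apply_of_notMem _ _ c hc, Equiv.swap_apply_of_ne_of_ne]
    · rintro rfl; exact hc ⟨a, rfl⟩
    · rintro rfl; exact hc ⟨b, rfl⟩

theorem shift_sim {s : Equiv.Perm (Fin m)} (hs : s ∈ Sim m) : shift hmn i s ∈ Sim n := by
  obtain ⟨a, b, hab, rfl⟩ := hs
  exact ⟨window hmn i a, window hmn i b, by change (a : ℕ) + i + 1 = b + i; omega,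
    shift_swap hmn i a b⟩

theorem len_shift_le (x : Equiv.Perm (Fin m)) : len (shift hmn i x) ≤ len x := by
  obtain ⟨l, hl, hlen⟩ := exists_isReduced x
  rw [← hlen, ← List.length_map (shift hmn i)]
  refine len_le ⟨fun s hs => ?_, by rw [← map_list_prod, hl.2]⟩
  obtain ⟨t, ht, rfl⟩ := List.mem_map.1 hs
  exact shift_sim hmn i (hl.1 t ht)

/-- Lengths add up in the product of a permutation that is increasing on the window and a
permutation of the window. -/
theorem len_mul_shift {d : Equiv.Perm (Fin n)} (hd : StrictMono (d ∘ window hmn i))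
    (x : Equiv.Perm (Fin m)) : len (d * shift hmn i x) = len d + len x := by
  induction hk : len x generalizing x with
  | zero => rw [eq_one_of_len hk, map_one, mul_one, add_zero]
  | succ k ih =>
    have h1 := len_mul_le d (shift hmn i x)
    have h2 := len_shift_le hmn i x
    obtain ⟨s, hs, h3⟩ := exists_sim_len_lt (x := x) (by rintro rfl; simp [len_one] at hk)
    have h4 := len_mul_sim (x := x) hs
    have h5 := ih (x * s) (by omega)
    -- Since `d` is increasing on the window, a descent of `x` remains a descent of the product.
    have h6 : len (d * shift hmn i (x * s)) < len (d * shift hmn i x) := by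
      obtain ⟨a, b, hab, rfl⟩ := hs
      have hab' : a < b := by rw [Fin.lt_def]; omega
      rw [map_mul, ← mul_assoc, shift_swap,
        len_mul_swap_lt_iff ((window_lt_window hmn i).2 hab'), Equiv.Perm.mul_apply,
        Equiv.Perm.mul_apply, shift_window, shift_window]
      exact hd ((len_mul_swap_lt_iff hab').1 h3)
    omega

theorem len_shift (x : Equiv.Perm (Fin m)) : len (shift hmn i x) = len x := by
  have := len_mul_shift hmn i (d := 1) (fun a b h => (window_lt_window hmn i).2 h) x
  rwa [one_mul, len_one, zero_add] at this

/-- The consecutive pattern of `z` at position `i`. -/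
noncomputable def pat (z : Equiv.Perm (Fin n)) : Equiv.Perm (Fin m) :=
  (Tuple.sort (z ∘ window hmn i))⁻¹

/-- The factor of `z` that is increasing on the window. -/
noncomputable def rep (z : Equiv.Perm (Fin n)) : Equiv.Perm (Fin n) :=
  z * (shift hmn i (pat hmn i z))⁻¹

theorem rep_mul_shift_pat (z : Equiv.Perm (Fin n)) :
    rep hmn i z * shift hmn i (pat hmn i z) = z := by
  simp [rep]

theorem rep_strictMono (z : Equiv.Perm (Fin n)) : StrictMono (rep hmn i z ∘ window hmn i) := by
  have h : rep hmn i z ∘ window hmn i =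
      (z ∘ window hmn i) ∘ Tuple.sort (z ∘ window hmn i) := by
    funext a
    simp only [rep, pat, map_inv, inv_inv, Function.comp_apply, Equiv.Perm.mul_apply, shift_window]
  rw [h]
  exact (Tuple.monotone_sort (z ∘ window hmn i)).strictMono_of_injective
    ((z.injective.comp (window hmn i).injective).comp (Equiv.injective _))

theorem eq_of_lt_iff_lt {p q : Equiv.Perm (Fin m)} (h : ∀ a b, p a < p b ↔ q a < q b) : p = q := by
  have h1 : StrictMono (q * p⁻¹ : Equiv.Perm (Fin m)) := fun a b hab => by
    have := (h (p⁻¹ a) (p⁻¹ b)).1 (by simpa using hab)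
    simpa using this
  have h2 : (q * p⁻¹ : Equiv.Perm (Fin m)) = 1 := by
    ext a
    have := DFunLike.congr_fun (Subsingleton.elim (h1.orderIsoOfSurjective _ (Equiv.surjective _))
      (OrderIso.refl _)) a
    simpa using congrArg Fin.val this
  exact (mul_inv_eq_one.1 h2).symm

/-- Uniqueness of the factorization: a factor increasing on the window does not affect the relative
order of the values there, and that order determines the pattern. -/
theorem pat_mul_shift {d : Equiv.Perm (Fin n)} (hd : StrictMono (d ∘ window hmn i))
    (x : Equiv.Perm (Fin m)) : pat hmn i (d * shift hmn i x) = x := by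
  refine eq_of_lt_iff_lt fun a b => ?_
  have h1 : ∀ a, (d * shift hmn i x) (window hmn i a) = d (window hmn i (x a)) := fun a => by
    rw [Equiv.Perm.mul_apply, shift_window]
  have h2 : ∀ a, (d * shift hmn i x) (window hmn i a) =
      rep hmn i (d * shift hmn i x) (window hmn i (pat hmn i (d * shift hmn i x) a)) := fun a => by
    conv_lhs => rw [← rep_mul_shift_pat hmn i (d * shift hmn i x)]
    rw [Equiv.Perm.mul_apply, shift_window]
  have h3 := (rep_strictMono hmn i (d * shift hmn i x)).lt_iff_lt
    (a := pat hmn i (d * shift hmn i x) a) (b := pat hmn i (d * shift hmn i x) b)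
  have h4 := hd.lt_iff_lt (a := x a) (b := x b)
  simp only [Function.comp_apply] at h3 h4
  rw [← h3, ← h2, ← h2, h1, h1, h4]

theorem rep_mul_shift {d : Equiv.Perm (Fin n)} (hd : StrictMono (d ∘ window hmn i))
    (x : Equiv.Perm (Fin m)) : rep hmn i (d * shift hmn i x) = d := by
  rw [rep, pat_mul_shift hmn i hd, mul_inv_cancel_right]

theorem pat_shift (x : Equiv.Perm (Fin m)) : pat hmn i (shift hmn i x) = x := by
  have := pat_mul_shift hmn i (d := 1) (fun a b h => (window_lt_window hmn i).2 h) x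
  rwa [one_mul] at this

theorem rep_shift (x : Equiv.Perm (Fin m)) : rep hmn i (shift hmn i x) = 1 := by
  rw [rep, pat_shift, mul_inv_cancel]

theorem len_rep_add_len_pat (z : Equiv.Perm (Fin n)) :
    len z = len (rep hmn i z) + len (pat hmn i z) := by
  rw [← len_mul_shift hmn i (rep_strictMono hmn i z), rep_mul_shift_pat]

theorem ConsecContains.pat_eq {z : Equiv.Perm (Fin n)} {p : Equiv.Perm (Fin m)}
    (h : ConsecContains hmn z p i) : pat hmn i z = p := by
  refine eq_of_lt_iff_lt fun a b => ?_
  have h2 : ∀ a, z (window hmn i a) = rep hmn i z (window hmn i (pat hmn i z a)) := fun a => by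
    conv_lhs => rw [← rep_mul_shift_pat hmn i z]
    rw [Equiv.Perm.mul_apply, shift_window]
  rw [h a b, h2, h2]
  exact (rep_strictMono hmn i z).lt_iff_lt.symm

theorem consecContains_shift (p : Equiv.Perm (Fin m)) :
    ConsecContains hmn (shift hmn i p) p i := fun a b => by
  rw [shift_window, shift_window, window_lt_window]

end Window

/-! ### The regular representation and the standard basis -/

section Regular

variable {n : ℕ}

/-- The diagonal coefficient of left multiplication by `T_s` on `T_w`. -/
noncomputable def coefL (s w : Equiv.Perm (Fin n)) : A :=
  if len (s * w) < len w then vinv - v else 0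

/-- The diagonal coefficient of right multiplication by `T_s` on `T_w`. -/
noncomputable def coefR (s w : Equiv.Perm (Fin n)) : A :=
  if len (w * s) < len w then vinv - v else 0

/-- The operator of left multiplication by `T_s` on the free module with basis `S_n`. -/
noncomputable def opL (s : Equiv.Perm (Fin n)) : Module.End A (Equiv.Perm (Fin n) →₀ A) :=
  Finsupp.linearCombination A fun w =>
    coefL s w • Finsupp.single w (1 : A) + Finsupp.single (s * w) 1

/-- The operator of right multiplication by `T_s` on the free module with basis `S_n`. -/
noncomputable def opR (s : Equiv.Perm (Fin n)) : Module.End A (Equiv.Perm (Fin n) →₀ A) :=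
  Finsupp.linearCombination A fun w =>
    coefR s w • Finsupp.single w (1 : A) + Finsupp.single (w * s) 1

theorem opL_single (s w : Equiv.Perm (Fin n)) :
    opL s (Finsupp.single w 1) = coefL s w • Finsupp.single w 1 + Finsupp.single (s * w) 1 := by
  rw [opL, Finsupp.linearCombination_single, one_smul]

theorem opR_single (s w : Equiv.Perm (Fin n)) :
    opR s (Finsupp.single w 1) = coefR s w • Finsupp.single w 1 + Finsupp.single (w * s) 1 := by
  rw [opR, Finsupp.linearCombination_single, one_smul]

theorem coefL_eq_coefR {s t w : Equiv.Perm (Fin n)} (h : s * w = w * t) :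
    coefL s w = coefR t w := by
  rw [coefL, coefR, h]

/-- If `s * w ≠ w * t`, multiplication on one side does not change the descent on the other, so the
diagonal coefficients agree. If `s * w = w * t`, left and right coefficients coincide. -/
theorem commute_opL_opR {s t : Equiv.Perm (Fin n)} (hs : s ∈ Sim n) (ht : t ∈ Sim n) :
    Commute (opL s) (opR t) := by
  refine Finsupp.lhom_ext' fun w => LinearMap.ext_ring ?_
  simp only [LinearMap.comp_apply, Finsupp.lsingle_apply, Module.End.mul_apply, opL_single,
    opR_single, map_add, map_smul, smul_add, ← mul_assoc]
  by_cases h : s * w = w * t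
  · have h1 : coefL s (w * t) = coefR t (s * w) := by
      rw [← h]
      refine coefL_eq_coefR ?_
      rw [← mul_assoc, Sim.mul_self hs, one_mul, h, mul_assoc, Sim.mul_self ht, mul_one]
    rw [h1, coefL_eq_coefR h, h]
  · have h1 : coefL s (w * t) = coefL s w := by
      unfold coefL
      congr 1
      by_contra h2
      exact h (sim_mul_eq_mul_sim hs ht fun h3 => h2 (propext h3))
    have h2 : coefR t (s * w) = coefR t w := by
      unfold coefR
      congr 1
      by_contra h2
      refine h ?_
      have h3 := sim_mul_eq_mul_sim (x := w⁻¹) ht hs fun h3 => h2 (propext ?_)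
      · rw [← inv_inj, mul_inv_rev, mul_inv_rev, Sim.inv hs, Sim.inv ht, h3]
      · rw [← len_inv (s * w * t), ← len_inv (s * w), ← len_inv (w * t), ← len_inv w]
        simpa [mul_inv_rev, Sim.inv hs, Sim.inv ht] using h3
    rw [h1, h2, smul_comm (coefL s w)]
    abel

/-- Right multiplications produce every basis vector from the one at 1. Hence each relation between
the operators `opT` has to be checked on a single vector only. -/
theorem end_ext_of_commute {f g : Module.End A (Equiv.Perm (Fin n) →₀ A)}
    (hf : ∀ t ∈ Sim n, Commute f (opR t)) (hg : ∀ t ∈ Sim n, Commute g (opR t))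
    (h : f (Finsupp.single 1 1) = g (Finsupp.single 1 1)) : f = g := by
  refine Finsupp.lhom_ext' fun w => LinearMap.ext_ring ?_
  simp only [LinearMap.comp_apply, Finsupp.lsingle_apply]
  induction hk : len w using Nat.strong_induction_on generalizing w with
  | _ k ih =>
    by_cases hw : w = 1
    · rw [hw, h]
    obtain ⟨t, ht, hlt⟩ := exists_sim_len_lt hw
    have hwt : w * t * t = w := by rw [mul_assoc, Sim.mul_self ht, mul_one]
    have h1 : opR t (Finsupp.single (w * t) 1) = Finsupp.single w 1 := by
      rw [opR_single, coefR, hwt, if_neg hlt.not_gt, zero_smul, zero_add]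
    rw [← h1, ← Module.End.mul_apply, ← Module.End.mul_apply, (hf t ht).eq, (hg t ht).eq,
      Module.End.mul_apply, Module.End.mul_apply, ih _ (hk ▸ hlt) _ rfl]

/-- The product of the operators of a word. -/
noncomputable def opWord (l : List (Equiv.Perm (Fin n))) :
    Module.End A (Equiv.Perm (Fin n) →₀ A) :=
  (l.map opL).prod

theorem commute_opWord_opR {l : List (Equiv.Perm (Fin n))} (hl : ∀ s ∈ l, s ∈ Sim n)
    {t : Equiv.Perm (Fin n)} (ht : t ∈ Sim n) : Commute (opWord l) (opR t) := by
  refine Commute.list_prod_left _ _ fun f hf => ?_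
  obtain ⟨s, hs, rfl⟩ := List.mem_map.1 hf
  exact commute_opL_opR (hl s hs) ht

theorem opWord_single_one {l : List (Equiv.Perm (Fin n))} (hl : IsReduced l l.prod) :
    opWord l (Finsupp.single 1 1) = Finsupp.single l.prod 1 := by
  induction l with
  | nil => simp [opWord]
  | cons s l ih =>
    obtain ⟨hs, h1, h2, h3⟩ := hl.of_cons
    rw [h2] at h3
    rw [opWord, List.map_cons, List.prod_cons, Module.End.mul_apply, ← opWord, ih h1, opL_single,
      coefL, if_neg (by omega), zero_smul, zero_add, List.prod_cons]

/-- The operator of left multiplication by `T_x` on the free module with basis `S_n`. -/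
noncomputable def opT (x : Equiv.Perm (Fin n)) : Module.End A (Equiv.Perm (Fin n) →₀ A) :=
  opWord (exists_isReduced x).choose

theorem commute_opT_opR (x : Equiv.Perm (Fin n)) {t : Equiv.Perm (Fin n)} (ht : t ∈ Sim n) :
    Commute (opT x) (opR t) :=
  commute_opWord_opR (exists_isReduced x).choose_spec.1.1 ht

theorem opT_single_one (x : Equiv.Perm (Fin n)) :
    opT x (Finsupp.single 1 1) = Finsupp.single x 1 := by
  have h := (exists_isReduced x).choose_spec
  rw [opT, opWord_single_one (by rwa [h.1.2]), h.1.2]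

theorem opT_one : opT (1 : Equiv.Perm (Fin n)) = 1 :=
  end_ext_of_commute (fun _ ht => commute_opT_opR _ ht) (fun _ _ => Commute.one_left _)
    (opT_single_one 1)

theorem opT_sim {s : Equiv.Perm (Fin n)} (hs : s ∈ Sim n) : opT s = opL s :=
  end_ext_of_commute (fun _ ht => commute_opT_opR _ ht) (fun _ ht => commute_opL_opR hs ht) (by
    rw [opT_single_one, opL_single, mul_one, coefL, mul_one, len_one, if_neg (Nat.not_lt_zero _),
      zero_smul, zero_add])

theorem opT_mul {x y : Equiv.Perm (Fin n)} (h : len (x * y) = len x + len y) :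
    opT x * opT y = opT (x * y) := by
  refine end_ext_of_commute (fun t ht => (commute_opT_opR x ht).mul_left (commute_opT_opR y ht))
    (fun t ht => commute_opT_opR _ ht) ?_
  have hx := (exists_isReduced x).choose_spec
  have hy := (exists_isReduced y).choose_spec
  have hp : ((exists_isReduced x).choose ++ (exists_isReduced y).choose).prod = x * y := by
    rw [List.prod_append, hx.1.2, hy.1.2]
  have h1 := opWord_single_one
    (l := (exists_isReduced x).choose ++ (exists_isReduced y).choose) (by
      rw [hp]
      refine ⟨⟨fun s hs => ?_, hp⟩, by rw [List.length_append, hx.2, hy.2, h]⟩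
      rcases List.mem_append.1 hs with hs | hs
      exacts [hx.1.1 s hs, hy.1.1 s hs])
  rw [opT_single_one, opT, opT, ← hp, ← h1]
  simp only [opWord, List.map_append, List.prod_append]

theorem len_eq_of_mem_desR {z s : Equiv.Perm (Fin n)} (h : s ∈ DesR z) :
    len (z * s * s) = len (z * s) + len s := by
  obtain ⟨hs, hlt⟩ := mem_desR_iff.1 h
  have := len_mul_sim (x := z) hs
  rw [mul_assoc, Sim.mul_self hs, mul_one, len_sim hs]
  omega

theorem opT_quad {z s : Equiv.Perm (Fin n)} (h : s ∈ DesR z) :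
    opT z * opT s = (vinv - v) • opT z + opT (z * s) := by
  obtain ⟨hs, hlt⟩ := mem_desR_iff.1 h
  refine end_ext_of_commute (fun t ht => (commute_opT_opR z ht).mul_left (commute_opT_opR s ht))
    (fun t ht => ((commute_opT_opR z ht).smul_left _).add_left (commute_opT_opR _ ht)) ?_
  have h1 := opT_mul (len_eq_of_mem_desR h)
  rw [mul_assoc, Sim.mul_self hs, mul_one] at h1
  have h2 : opT s (Finsupp.single s 1) =
      (vinv - v) • Finsupp.single s 1 + Finsupp.single 1 1 := by
    rw [opT_sim hs, opL_single, coefL, Sim.mul_self hs, len_one, len_sim hs, if_pos Nat.one_pos]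
  have h3 : opT (z * s) (Finsupp.single s 1) = Finsupp.single z 1 := by
    rw [← opT_single_one s, ← Module.End.mul_apply, h1, opT_single_one]
  rw [Module.End.mul_apply, opT_single_one, ← h1, Module.End.mul_apply, h2, map_add, map_smul, h3,
    opT_single_one, h1, LinearMap.add_apply, LinearMap.smul_apply, opT_single_one, opT_single_one]

theorem lift_opT_rel ⦃a b : FreeAlgebra A (Equiv.Perm (Fin n))⦄ (h : HeckeRel n a b) :
    FreeAlgebra.lift A opT a = FreeAlgebra.lift A opT b := by
  cases h with
  | one => rw [FreeAlgebra.lift_ι_apply, opT_one, map_one]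
  | mul x y h => simp only [map_mul, FreeAlgebra.lift_ι_apply, opT_mul h]
  | quad z s h => simp only [map_mul, map_add, map_smul, FreeAlgebra.lift_ι_apply, opT_quad h]

/-- The regular representation of the Hecke algebra. -/
noncomputable def regRep (n : ℕ) : Hecke n →ₐ[A] Module.End A (Equiv.Perm (Fin n) →₀ A) :=
  RingQuot.liftAlgHom A ⟨FreeAlgebra.lift A opT, lift_opT_rel⟩

theorem regRep_T (x : Equiv.Perm (Fin n)) : regRep n (T x) = opT x :=
  (RingQuot.liftAlgHom_mkAlgHom_apply A (FreeAlgebra.lift A opT) lift_opT_rel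
    (FreeAlgebra.ι A x)).trans (FreeAlgebra.lift_ι_apply opT x)

theorem linearIndependent_T : LinearIndependent A (T (n := n)) := by
  let f : Hecke n →ₗ[A] (Equiv.Perm (Fin n) →₀ A) :=
    (LinearMap.applyₗ (Finsupp.single 1 1)).comp (regRep n).toLinearMap
  have hf : f ∘ T = fun x => Finsupp.single x (1 : A) := by
    funext x
    change regRep n (T x) (Finsupp.single 1 1) = _
    rw [regRep_T, opT_single_one]
  refine LinearIndependent.of_comp f ?_
  rw [hf]
  exact Finsupp.linearIndependent_single_one A _

theorem T_mul_T_sim (z : Equiv.Perm (Fin n)) {s : Equiv.Perm (Fin n)} (hs : s ∈ Sim n) :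
    T z * T s = coefR s z • T z + T (z * s) := by
  rw [coefR]
  split_ifs with h
  · exact T_quad (mem_desR_iff.2 ⟨hs, h⟩)
  · rw [zero_smul, zero_add, T_mul]
    have := len_mul_sim (x := z) hs
    rw [len_sim hs]
    omega

theorem T_eq_prod {l : List (Equiv.Perm (Fin n))} (hl : IsReduced l l.prod) :
    T l.prod = (l.map T).prod := by
  induction l with
  | nil => simp [T_one]
  | cons s l ih =>
    obtain ⟨hs, h1, h2, h3⟩ := hl.of_cons
    rw [List.map_cons, List.prod_cons, List.prod_cons, ← ih h1, T_mul]
    rw [← h2, h3, len_sim hs, add_comm]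

/-- The span of the `T_x` is stable under right multiplication, since `T_x` is a product of `T_s`.
Taking `h = 1` then shows that it is everything. -/
theorem mul_mk_mem_span_T (a : FreeAlgebra A (Equiv.Perm (Fin n))) (h : Hecke n)
    (hh : h ∈ Submodule.span A (Set.range (T (n := n)))) :
    h * Hecke.mk n a ∈ Submodule.span A (Set.range (T (n := n))) := by
  induction a using FreeAlgebra.induction generalizing h with
  | grade0 r =>
    rw [AlgHom.commutes, ← Algebra.commutes, ← Algebra.smul_def]
    exact Submodule.smul_mem _ _ hh
  | grade1 x =>
    change h * T x ∈ _
    obtain ⟨l, hl⟩ := exists_isReduced x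
    rw [← hl.1.2, T_eq_prod (by rwa [hl.1.2])]
    have hS := hl.1.1
    clear hl
    induction l generalizing h with
    | nil => simpa
    | cons s l ih =>
      rw [List.map_cons, List.prod_cons, ← mul_assoc]
      refine ih _ ?_ fun t ht => hS t (by simp [ht])
      induction hh using Submodule.span_induction with
      | mem y hy =>
        obtain ⟨z, rfl⟩ := hy
        rw [T_mul_T_sim z (hS s (by simp))]
        exact add_mem (Submodule.smul_mem _ _ (Submodule.subset_span ⟨z, rfl⟩))
          (Submodule.subset_span ⟨_, rfl⟩)
      | zero => simp
      | add y z _ _ hy hz => rw [add_mul]; exact add_mem hy hz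
      | smul r y _ hy => rw [smul_mul_assoc]; exact Submodule.smul_mem _ _ hy
  | mul a b iha ihb => rw [map_mul, ← mul_assoc]; exact ihb _ (iha _ hh)
  | add a b iha ihb => rw [map_add, mul_add]; exact add_mem (iha _ hh) (ihb _ hh)

theorem span_T : Submodule.span A (Set.range (T (n := n))) = ⊤ := by
  refine eq_top_iff.2 fun h _ => ?_
  obtain ⟨a, rfl⟩ := RingQuot.mkAlgHom_surjective A (HeckeRel n) h
  have := mul_mk_mem_span_T a 1 (Submodule.subset_span ⟨1, T_one⟩)
  rwa [one_mul] at this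

/-- The standard basis of the Hecke algebra. -/
noncomputable def basisT (n : ℕ) : Module.Basis (Equiv.Perm (Fin n)) A (Hecke n) :=
  Module.Basis.mk linearIndependent_T span_T.ge

theorem basisT_apply (x : Equiv.Perm (Fin n)) : basisT n x = T x :=
  Module.Basis.mk_apply _ _ x

theorem coe_basisT : ⇑(basisT n) = T :=
  funext basisT_apply

end Regular

/-! ### Triangularity of the bar involution -/

section Bar

variable {n : ℕ}

theorem bar_smul (a : A) (h : Hecke n) :
    bar n (a • h) = LaurentPolynomial.invert a • bar n h := by
  rw [Algebra.smul_def, map_mul, bar_algebraMap, ← Algebra.smul_def]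

theorem bruhatLT_mul_sim {w s : Equiv.Perm (Fin n)} (hs : s ∈ Sim n) (h : len w < len (w * s)) :
    BruhatLT w (w * s) := by
  have h1 : w * s * s = w := by rw [mul_assoc, Sim.mul_self hs, mul_one]
  have := (mem_desR_iff.2 ⟨hs, by rwa [h1]⟩ : s ∈ DesR (w * s)).2
  rwa [h1] at this

theorem BruhatLT.mul_sim {y w s : Equiv.Perm (Fin n)} (hy : BruhatLT y w) (hs : s ∈ Sim n)
    (h : len w < len (w * s)) : BruhatLT (y * s) (w * s) := by
  have hw := bruhatLT_mul_sim hs h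
  rcases len_mul_sim (x := y) hs with h1 | h1
  · refine ⟨?_, fun e => hy.2 (mul_right_cancel e)⟩
    obtain ⟨l, l', h2, h3, h4⟩ := hy.1
    exact ⟨l ++ [s], l' ++ [s], h2.append_sim hs h, h3.append (List.Sublist.refl _),
      h4.append_sim hs (by omega)⟩
  · have h2 := (mem_desR_iff.2 ⟨hs, by omega⟩ : s ∈ DesR y).2
    exact (h2.trans hy).trans hw

theorem bar_T_sub_mem (w : Equiv.Perm (Fin n)) :
    bar n (T w) - T w ∈ Submodule.span A (T '' {y | BruhatLT y w}) := by
  rw [bar_T]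
  induction hk : len w generalizing w with
  | zero => rw [eq_one_of_len hk, barT_one, T_one, sub_self]; exact zero_mem _
  | succ k ih =>
    obtain ⟨s, hs, hlt⟩ := exists_sim_len_lt (x := w) (by rintro rfl; simp [len_one] at hk)
    obtain ⟨u, rfl⟩ : ∃ u, w = u * s := ⟨w * s, by rw [mul_assoc, Sim.mul_self hs, mul_one]⟩
    rw [mul_assoc, Sim.mul_self hs, mul_one] at hlt
    have hlen : len (u * s) = len u + len s := by
      have := len_mul_sim (x := u) hs
      rw [len_sim hs]
      omega
    have hu := bruhatLT_mul_sim hs hlt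
    -- As `barT s` is `T s` minus a scalar, peeling off `s` costs only a multiple of `T u`, and
    -- multiplying the error of `u` by `barT s` keeps it below `u * s`.
    have h1 : barT (u * s) - T (u * s) = (barT u - T u) * barT s - (vinv - v) • T u := by
      rw [← barT_mul hlen, ← T_mul hlen, sub_mul, barT_sim hs, mul_sub (T u), mul_smul_comm,
        mul_one]
      abel
    rw [h1]
    refine sub_mem ?_ (Submodule.smul_mem _ _ (Submodule.subset_span ⟨u, hu, rfl⟩))
    have h2 := ih u (by rw [len_sim hs] at hlen; omega)
    generalize barT u - T u = c at h2 ⊢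
    induction h2 using Submodule.span_induction with
    | mem y hy =>
      obtain ⟨y, hy, rfl⟩ := hy
      rw [barT_sim hs, mul_sub, mul_smul_comm, mul_one, T_mul_T_sim y hs]
      have h3 : T y ∈ Submodule.span A (T '' {y | BruhatLT y (u * s)}) :=
        Submodule.subset_span ⟨y, BruhatLT.trans hy hu, rfl⟩
      exact sub_mem (add_mem (Submodule.smul_mem _ _ h3)
        (Submodule.subset_span ⟨y * s, BruhatLT.mul_sim hy hs hlt, rfl⟩))
        (Submodule.smul_mem _ _ h3)
    | zero => simp
    | add y z _ _ hy hz => rw [add_mul]; exact add_mem hy hz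
    | smul r y _ hy => rw [smul_mul_assoc]; exact Submodule.smul_mem _ _ hy

theorem bar_bar (h : Hecke n) : bar n (bar n h) = h := by
  have hT : ∀ x : Equiv.Perm (Fin n), bar n (bar n (T x)) = T x := fun x => by
    have h1 : T x * barT x⁻¹ = 1 := by simpa using T_mul_barT x⁻¹
    have h2 : barT x⁻¹ * bar n (barT x) = 1 := by rw [← bar_T, ← map_mul, T_mul_barT, map_one]
    rw [bar_T]
    exact (left_inv_eq_right_inv h1 h2).symm
  have := (span_T (n := n)).ge (Submodule.mem_top (x := h))
  induction this using Submodule.span_induction with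
  | mem y hy => obtain ⟨x, rfl⟩ := hy; exact hT x
  | zero => simp
  | add y z _ _ hy hz => rw [map_add, map_add, hy, hz]
  | smul r y _ hy => rw [bar_smul, bar_smul, hy, LaurentPolynomial.involutive_invert r]

end Bar

/-! ### The ideal `v ℤ[v]` -/

section VPoly

/-- The non-unital subring `v ℤ[v]` of `ℤ[v, v⁻¹]`. -/
noncomputable def vPoly : NonUnitalSubring A where
  carrier := {a | ∃ q : Polynomial ℤ, a = v * Polynomial.toLaurent q}
  zero_mem' := ⟨0, by simp⟩
  add_mem' := by
    rintro _ _ ⟨p, rfl⟩ ⟨q, rfl⟩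
    exact ⟨p + q, by rw [map_add, mul_add]⟩
  neg_mem' := by
    rintro _ ⟨p, rfl⟩
    exact ⟨-p, by rw [map_neg, mul_neg]⟩
  mul_mem' := by
    rintro _ _ ⟨p, rfl⟩ ⟨q, rfl⟩
    refine ⟨p * Polynomial.X * q, ?_⟩
    rw [map_mul, map_mul, Polynomial.toLaurent_X, v]
    ring

theorem mem_vPoly {a : A} : a ∈ vPoly ↔ ∃ q : Polynomial ℤ, a = v * Polynomial.toLaurent q :=
  Iff.rfl

theorem coeff_of_mem_vPoly {a : A} (ha : a ∈ vPoly) {k : ℤ} (hk : k ≤ 0) : a.coeff k = 0 := by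
  obtain ⟨q, rfl⟩ := ha
  rw [v, ← Polynomial.toLaurent_X, ← map_mul, LaurentPolynomial.coeff_toLaurent]
  rcases hk.lt_or_eq with hk | rfl
  · refine Finsupp.mapDomain_of_notMem_range _ _ ?_
    rintro ⟨j, rfl⟩
    simp at hk
    omega
  · have := Finsupp.mapDomain_apply (f := ((↑) : ℕ → ℤ)) Nat.cast_injective
      (Polynomial.X * q).toFinsupp.coeff 0
    rw [Nat.cast_zero] at this
    exact this.trans (Polynomial.coeff_X_mul_zero q)

theorem T_mem_vPoly (k : ℕ) (a : ℤ) :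
    LaurentPolynomial.C a * LaurentPolynomial.T ((k : ℤ) + 1) ∈ vPoly := by
  refine ⟨Polynomial.C a * Polynomial.X ^ k, ?_⟩
  rw [Polynomial.toLaurent_C_mul_X_pow, LaurentPolynomial.T_add, v]
  ring

theorem exists_vPoly_decomp (a : A) : ∃ q ∈ vPoly, ∃ q' ∈ vPoly, ∃ c : ℤ,
    a = q + LaurentPolynomial.invert q' + LaurentPolynomial.C c := by
  induction a using LaurentPolynomial.induction_on' with
  | add a b ha hb =>
    obtain ⟨q, hq, q', hq', c, rfl⟩ := ha
    obtain ⟨r, hr, r', hr', d, rfl⟩ := hb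
    refine ⟨q + r, add_mem hq hr, q' + r', add_mem hq' hr', c + d, ?_⟩
    rw [map_add, map_add]
    ring
  | C_mul_T k a =>
    rcases lt_trichotomy k 0 with hk | rfl | hk
    · obtain ⟨j, rfl⟩ : ∃ j : ℕ, k = -((j : ℤ) + 1) := ⟨(-k - 1).toNat, by omega⟩
      exact ⟨0, zero_mem _, _, T_mem_vPoly j a, 0, by simp⟩
    · exact ⟨0, zero_mem _, 0, zero_mem _, a, by simp⟩
    · obtain ⟨j, rfl⟩ : ∃ j : ℕ, k = (j : ℤ) + 1 := ⟨(k - 1).toNat, by omega⟩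
      exact ⟨_, T_mem_vPoly j a, 0, zero_mem _, 0, by simp⟩

theorem eq_zero_of_mem_vPoly {a : A} (ha : a ∈ vPoly) (h : LaurentPolynomial.invert a = a) :
    a = 0 := by
  refine LaurentPolynomial.ext fun k => ?_
  rw [AddMonoidAlgebra.coeff_zero, Finsupp.zero_apply]
  rcases le_total k 0 with hk | hk
  · exact coeff_of_mem_vPoly ha hk
  · rw [← h, LaurentPolynomial.invert_apply]
    exact coeff_of_mem_vPoly ha (by omega)

/-- An antisymmetric Laurent polynomial is its positive part minus the mirror image; its constant
term `c` vanishes because `2 * c = 0` in `ℤ`. -/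
theorem exists_sub_invert {a : A} (h : a + LaurentPolynomial.invert a = 0) :
    ∃ q ∈ vPoly, a = q - LaurentPolynomial.invert q := by
  obtain ⟨q, hq, q', hq', c, rfl⟩ := exists_vPoly_decomp a
  have hs : q + q' ∈ vPoly := add_mem hq hq'
  have h1 : (q + q') + LaurentPolynomial.invert (q + q') + LaurentPolynomial.C (2 * c) = 0 := by
    rw [← h]
    simp only [map_add, LaurentPolynomial.invert_C, LaurentPolynomial.involutive_invert q', two_mul]
    ring
  have h2 : c = 0 ∧ q + q' = 0 := by
    generalize q + q' = s at hs h1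
    have h2 : ∀ k, s.coeff k + s.coeff (-k) + (if k = 0 then 2 * c else 0) = 0 := fun k => by
      simpa only [AddMonoidAlgebra.coeff_add, Finsupp.add_apply, LaurentPolynomial.invert_apply,
        LaurentPolynomial.C_apply, AddMonoidAlgebra.coeff_zero, Finsupp.zero_apply] using
        congrArg (fun f : A => f.coeff k) h1
    refine ⟨?_, LaurentPolynomial.ext fun k => ?_⟩
    · have := h2 0
      rw [neg_zero, coeff_of_mem_vPoly hs le_rfl, if_pos rfl] at this
      omega
    · rcases le_or_gt k 0 with hk | hk
      · exact coeff_of_mem_vPoly hs hk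
      · have := h2 k
        rwa [coeff_of_mem_vPoly hs (k := -k) (by omega), if_neg hk.ne', add_zero, add_zero] at this
  obtain ⟨rfl, h2⟩ := h2
  refine ⟨q, hq, ?_⟩
  rw [← neg_eq_of_add_eq_zero_right h2, map_neg]
  simp [sub_eq_add_neg]

end VPoly

/-! ### Unitriangular families -/

section Lattice

variable {ι M : Type*} [AddCommGroup M] [Module A M]

/-- The additive group of combinations of the `e j`, `P j`, with coefficients in `S`. -/
def lat (S : NonUnitalSubring A) (e : ι → M) (P : ι → Prop) : AddSubgroup M :=
  AddSubgroup.closure {x | ∃ a ∈ S, ∃ j, P j ∧ x = a • e j}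

theorem smul_mem_lat {S : NonUnitalSubring A} {e : ι → M} {P : ι → Prop} {a : A} (ha : a ∈ S)
    {j : ι} (hj : P j) : a • e j ∈ lat S e P :=
  AddSubgroup.subset_closure ⟨a, ha, j, hj, rfl⟩

theorem lat_le {S : NonUnitalSubring A} {e : ι → M} {P : ι → Prop} {N : AddSubgroup M}
    (h : ∀ a ∈ S, ∀ j, P j → a • e j ∈ N) : lat S e P ≤ N := by
  refine (AddSubgroup.closure_le N).2 ?_
  rintro _ ⟨a, ha, j, hj, rfl⟩
  exact h a ha j hj

theorem lat_mono {S S' : NonUnitalSubring A} {e : ι → M} {P P' : ι → Prop} (hS : S ≤ S')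
    (hP : ∀ j, P j → P' j) : lat S e P ≤ lat S' e P' :=
  lat_le fun _ ha _ hj => smul_mem_lat (hS ha) (hP _ hj)

theorem lat.smul_mem {S : NonUnitalSubring A} {e : ι → M} {P : ι → Prop} {a : A} (ha : a ∈ S)
    {x : M} (hx : x ∈ lat S e P) : a • x ∈ lat S e P := by
  have : lat S e P ≤ (lat S e P).comap (DistribSMul.toAddMonoidHom M a) :=
    lat_le fun b hb j hj => by
      change a • b • e j ∈ lat S e P
      rw [smul_smul]
      exact smul_mem_lat (mul_mem ha hb) hj
  exact this hx

theorem span_le_lat {e : ι → M} {P : ι → Prop} {x : M}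
    (hx : x ∈ Submodule.span A (e '' {j | P j})) : x ∈ lat ⊤ e P := by
  induction hx using Submodule.span_induction with
  | mem y hy =>
    obtain ⟨j, hj, rfl⟩ := hy
    rw [← one_smul A (e j)]
    exact smul_mem_lat (NonUnitalSubring.mem_top _) hj
  | zero => exact zero_mem _
  | add y z _ _ hy hz => exact add_mem hy hz
  | smul a y _ hy => exact lat.smul_mem (NonUnitalSubring.mem_top _) hy

theorem lat_le_span {S : NonUnitalSubring A} {e : ι → M} {P : ι → Prop} {x : M}
    (hx : x ∈ lat S e P) : x ∈ Submodule.span A (e '' {j | P j}) := by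
  have : lat S e P ≤ (Submodule.span A (e '' {j | P j})).toAddSubgroup :=
    lat_le fun a _ j hj => Submodule.smul_mem _ a (Submodule.subset_span ⟨j, hj, rfl⟩)
  exact this hx

theorem mem_lat_iff [Fintype ι] {S : NonUnitalSubring A} {e : ι → M} {P : ι → Prop} {x : M} :
    x ∈ lat S e P ↔
      ∃ p : ι → A, (∀ j, p j ∈ S) ∧ (∀ j, ¬ P j → p j = 0) ∧ x = ∑ j, p j • e j := by
  classical
  constructor
  · intro hx
    induction hx using AddSubgroup.closure_induction with
    | mem y hy =>
      obtain ⟨a, ha, j, hj, rfl⟩ := hy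
      refine ⟨Pi.single j a, fun k => ?_, fun k hk => ?_, ?_⟩
      · by_cases h : k = j
        · subst h; simpa
        · simp [h, zero_mem]
      · exact Pi.single_eq_of_ne (by rintro rfl; exact hk hj) _
      · rw [Finset.sum_eq_single j] <;> simp +contextual
    | zero => exact ⟨0, fun _ => zero_mem _, fun _ _ => rfl, by simp⟩
    | add y z _ _ hy hz =>
      obtain ⟨p, hp, hp', rfl⟩ := hy
      obtain ⟨q, hq, hq', rfl⟩ := hz
      exact ⟨p + q, fun j => add_mem (hp j) (hq j), fun j hj => by simp [hp' j hj, hq' j hj],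
        by simp [add_smul, Finset.sum_add_distrib]⟩
    | neg y _ hy =>
      obtain ⟨p, hp, hp', rfl⟩ := hy
      exact ⟨-p, fun j => neg_mem (hp j), fun j hj => by simp [hp' j hj], by simp⟩
  · rintro ⟨p, hp, hp', rfl⟩
    refine sum_mem fun j _ => ?_
    by_cases hj : P j
    · exact smul_mem_lat (hp j) hj
    · rw [hp' j hj, zero_smul]; exact zero_mem _

variable {r : ι → ι → Prop}

/-- A family that is unitriangular over `e` spans no more than `e` over a lower set. -/
theorem lat_le_lat {S : NonUnitalSubring A} {e c : ι → M} {P : ι → Prop}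
    (hP : ∀ j, P j → ∀ k, r k j → P k) (h : ∀ j, P j → c j - e j ∈ lat S e (r · j)) :
    lat S c P ≤ lat S e P :=
  lat_le fun a ha j hj => by
    rw [← add_sub_cancel (e j) (c j), smul_add]
    exact add_mem (smul_mem_lat ha hj) (lat.smul_mem ha (lat_mono le_rfl (hP j hj) (h j hj)))

/-- The inverse of a unitriangular matrix is unitriangular with off-diagonal entries in the same
`S`. Only closure of `S` under ring operations is used, not a unit, so `vPoly` is allowed. -/
theorem sub_mem_lat_symm (hr : WellFounded r) (ht : ∀ {i j k}, r i j → r j k → r i k)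
    {S : NonUnitalSubring A} {e c : ι → M} (h : ∀ j, c j - e j ∈ lat S e (r · j)) (j : ι) :
    e j - c j ∈ lat S c (r · j) := by
  induction j using hr.induction with
  | _ j ih =>
    rw [← neg_sub]
    exact neg_mem (lat_le_lat (fun k hk l hl => ht hl hk) ih (h j))

/-- Triangularity gives a surjective endomorphism of a finite module, which is then bijective;
linear independence needs no separate argument. -/
theorem exists_basis_of_unitriangular [Finite ι] (hr : WellFounded r)
    (ht : ∀ {i j k}, r i j → r j k → r i k) {S : NonUnitalSubring A} (e : Module.Basis ι A M)
    {c : ι → M} (h : ∀ j, c j - e j ∈ lat S e (r · j)) :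
    ∃ b : Module.Basis ι A M, ⇑b = c := by
  have hfin : Module.Finite A M := Module.Finite.of_basis e
  have hsurj : Function.Surjective (e.constr A c) := by
    rw [← LinearMap.range_eq_top, e.constr_range, eq_top_iff, ← e.span_eq, Submodule.span_le]
    rintro _ ⟨j, rfl⟩
    have h1 := Submodule.span_mono (Set.image_subset_range c {k | r k j})
      (lat_le_span (sub_mem_lat_symm hr ht h j))
    rw [← sub_add_cancel (e j) (c j)]
    exact add_mem h1 (Submodule.subset_span ⟨j, rfl⟩)
  refine ⟨e.map (LinearEquiv.ofBijective (e.constr A c)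
    (OrzechProperty.bijective_of_surjective_endomorphism _ hsurj)), funext fun j => ?_⟩
  rw [Module.Basis.map_apply, LinearEquiv.ofBijective_apply, Module.Basis.constr_basis]

variable {σ : M →+ M}

/-- Existence of bar-invariant elements that are unitriangular with coefficients in `v ℤ[v]`. -/
theorem exists_invariant [Fintype ι] (hr : WellFounded r)
    (ht : ∀ {i j k}, r i j → r j k → r i k)
    (hσ : ∀ (a : A) x, σ (a • x) = LaurentPolynomial.invert a • σ x) (hσσ : ∀ x, σ (σ x) = x)
    (e : Module.Basis ι A M) (he : ∀ i, σ (e i) - e i ∈ lat ⊤ e (r · i)) (i : ι) :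
    ∃ c, σ c = c ∧ c - e i ∈ lat vPoly e (r · i) := by
  classical
  induction i using hr.induction with
  | _ i ih =>
    choose! g hg hg' using ih
    -- Invariant elements are known only below `i`. Keeping `e j` elsewhere makes `c` a full basis.
    let c : ι → M := fun j => if r j i then g j else e j
    have hc : ∀ j, c j - e j ∈ lat vPoly e (r · j) := fun j => by
      by_cases h : r j i
      · simpa only [c, if_pos h] using hg' j h
      · simp only [c, if_neg h, sub_self, zero_mem]
    obtain ⟨b, hb⟩ := exists_basis_of_unitriangular hr ht e hc
    have hc' := sub_mem_lat_symm hr ht hc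
    have h1 : σ (e i) - e i ∈ lat ⊤ c (r · i) :=
      lat_le_lat (fun k hk l hl => ht hl hk)
        (fun j _ => lat_mono (le_top : vPoly ≤ ⊤) (fun _ h => h) (hc' j)) (he i)
    obtain ⟨p, -, hp, hpe⟩ := mem_lat_iff.1 h1
    have hinv : ∀ q : ι → A, (∀ j, ¬ r j i → q j = 0) →
        σ (∑ j, q j • c j) = ∑ j, LaurentPolynomial.invert (q j) • c j := fun q hq => by
      rw [map_sum]
      refine Finset.sum_congr rfl fun j _ => ?_
      rw [hσ]
      by_cases h : r j i
      · simp only [c, if_pos h, hg j h]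
      · rw [hq j h, map_zero, zero_smul, zero_smul]
    -- `σ` negates `σ (e i) - e i`, so its coefficients are antisymmetric. Writing `p j = q j -
    -- invert (q j)`, the correction `∑ q j • c j` makes `e i` invariant.
    have h2 : ∑ j, (p j + LaurentPolynomial.invert (p j)) • b j = 0 := by
      have h3 := congrArg σ hpe
      rw [hinv p hp, map_sub, hσσ, ← neg_sub, hpe] at h3
      simp only [hb, add_smul, Finset.sum_add_distrib, ← h3]
      abel
    have h3 := fun j => Fintype.linearIndependent_iff.1 b.linearIndependent _ h2 j
    choose q hq hpq using fun j => exists_sub_invert (h3 j)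
    have hq0 : ∀ j, ¬ r j i → q j = 0 := fun j hj =>
      eq_zero_of_mem_vPoly (hq j) (sub_eq_zero.1 ((hpq j).symm.trans (hp j hj))).symm
    refine ⟨e i + ∑ j, q j • c j, ?_, ?_⟩
    · rw [map_add, hinv q hq0, ← sub_add_cancel (σ (e i)) (e i), hpe]
      simp only [hpq, sub_smul, Finset.sum_sub_distrib]
      abel
    · rw [add_sub_cancel_left]
      exact lat_le_lat (fun k hk l hl => ht hl hk) (fun j _ => hc j)
        (mem_lat_iff.2 ⟨q, hq, hq0, rfl⟩)

/-- In a basis of invariant vectors an invariant vector has symmetric coefficients, and `v ℤ[v]`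
contains no nonzero symmetric element. -/
theorem eq_zero_of_invariant [Fintype ι]
    (hσ : ∀ (a : A) x, σ (a • x) = LaurentPolynomial.invert a • σ x)
    (b : Module.Basis ι A M) (hb : ∀ i, σ (b i) = b i) {P : ι → Prop} {x : M}
    (hx : x ∈ lat vPoly b P) (hσx : σ x = x) : x = 0 := by
  obtain ⟨p, hp, -, rfl⟩ := mem_lat_iff.1 hx
  have h1 : ∑ j, (LaurentPolynomial.invert (p j) - p j) • b j = 0 := by
    simp only [map_sum, hσ, hb] at hσx
    simp only [sub_smul, Finset.sum_sub_distrib, hσx, sub_self]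
  refine Finset.sum_eq_zero fun j _ => ?_
  rw [eq_zero_of_mem_vPoly (hp j)
    (sub_eq_zero.1 (Fintype.linearIndependent_iff.1 b.linearIndependent _ h1 j)), zero_smul]

end Lattice

/-! ### The Kazhdan–Lusztig basis -/

section KLBasis

variable {n : ℕ}

theorem wellFounded_bruhatLT : WellFounded (BruhatLT (n := n)) :=
  Subrelation.wf (fun h => len_lt_of_bruhatLT h) (InvImage.wf len Nat.lt_wfRel.wf)

theorem isKLElement_iff {x : Equiv.Perm (Fin n)} {c : Hecke n} :
    IsKLElement x c ↔ bar n c = c ∧ c - T x ∈ lat vPoly T (BruhatLT · x) := by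
  rw [IsKLElement, mem_lat_iff]
  simp only [mem_vPoly, sub_eq_iff_eq_add']

theorem exists_isKLBasis (n : ℕ) :
    ∃ C : Module.Basis (Equiv.Perm (Fin n)) A (Hecke n), IsKLBasis C := by
  choose c hc hc' using exists_invariant (σ := (bar n).toAddMonoidHom) wellFounded_bruhatLT
    BruhatLT.trans bar_smul bar_bar (basisT n) fun i => by
      rw [coe_basisT]
      exact span_le_lat (bar_T_sub_mem i)
  obtain ⟨b, hb⟩ := exists_basis_of_unitriangular wellFounded_bruhatLT BruhatLT.trans (basisT n) hc'
  rw [coe_basisT] at hc'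
  exact ⟨b, fun x => isKLElement_iff.2 (hb ▸ ⟨hc x, hc' x⟩)⟩

/-- The Kazhdan–Lusztig basis. -/
noncomputable def klBasis (n : ℕ) : Module.Basis (Equiv.Perm (Fin n)) A (Hecke n) :=
  (exists_isKLBasis n).choose

theorem isKLBasis_klBasis : IsKLBasis (klBasis n) :=
  (exists_isKLBasis n).choose_spec

theorem bar_klBasis (x : Equiv.Perm (Fin n)) : bar n (klBasis n x) = klBasis n x :=
  (isKLBasis_klBasis x).1

theorem klBasis_sub_mem (x : Equiv.Perm (Fin n)) :
    klBasis n x - T x ∈ lat vPoly T (BruhatLT · x) :=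
  (isKLElement_iff.1 (isKLBasis_klBasis x)).2

/-- No Bruhat bound on the lower terms is needed. This weak form recognises `C_w` from expansions
whose terms are not controlled by the Bruhat order, as for `mixed`. -/
theorem eq_klBasis {x : Equiv.Perm (Fin n)} {c : Hecke n} (hc : bar n c = c)
    (h : c - T x ∈ lat vPoly T fun _ => True) : c = klBasis n x := by
  refine sub_eq_zero.1 (eq_zero_of_invariant (σ := (bar n).toAddMonoidHom) bar_smul (klBasis n)
    bar_klBasis (P := fun _ => True) ?_ ?_)
  · refine lat_le_lat (e := klBasis n) (c := T) (r := BruhatLT) (fun _ _ _ _ => trivial)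
      (fun j _ => sub_mem_lat_symm wellFounded_bruhatLT BruhatLT.trans klBasis_sub_mem j) ?_
    rw [← sub_sub_sub_cancel_right _ _ (T x)]
    exact sub_mem h (lat_mono le_rfl (fun _ _ => trivial) (klBasis_sub_mem x))
  · change bar n (c - klBasis n x) = _
    rw [map_sub, hc, bar_klBasis]

theorem IsKLBasis.eq_klBasis {C : Module.Basis (Equiv.Perm (Fin n)) A (Hecke n)}
    (hC : IsKLBasis C) : C = klBasis n :=
  Module.Basis.eq_of_apply_eq fun x =>
    KL.eq_klBasis (hC x).1 (lat_mono le_rfl (fun _ _ => trivial) (isKLElement_iff.1 (hC x)).2)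

theorem leftLE_iff {x y : Equiv.Perm (Fin n)} :
    LeftLE x y ↔ Relation.ReflTransGen
      (fun a b => ∃ h : Hecke n, (klBasis n).repr (h * klBasis n a) b ≠ 0) x y := by
  constructor
  · rintro ⟨C, hC, h⟩
    rwa [hC.eq_klBasis] at h
  · exact fun h => ⟨klBasis n, isKLBasis_klBasis, h⟩

theorem LeftLE.refl (x : Equiv.Perm (Fin n)) : LeftLE x x :=
  leftLE_iff.2 .refl

theorem LeftLE.trans {x y z : Equiv.Perm (Fin n)} (h : LeftLE x y) (h' : LeftLE y z) :
    LeftLE x z :=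
  leftLE_iff.2 ((leftLE_iff.1 h).trans (leftLE_iff.1 h'))

theorem leftLE_of_repr_ne_zero {x y : Equiv.Perm (Fin n)} (h : Hecke n)
    (hxy : (klBasis n).repr (h * klBasis n x) y ≠ 0) : LeftLE x y :=
  leftLE_iff.2 (.single ⟨h, hxy⟩)

end KLBasis

/-! ### Parabolic restriction of the Kazhdan–Lusztig basis -/

section Parabolic

variable {m n : ℕ} (hmn : m ≤ n) (i : Fin (n - m + 1))

theorem lift_shift_rel ⦃a b : FreeAlgebra A (Equiv.Perm (Fin m))⦄ (h : HeckeRel m a b) :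
    FreeAlgebra.lift A (fun x => T (shift hmn i x)) a =
      FreeAlgebra.lift A (fun x => T (shift hmn i x)) b := by
  cases h with
  | one => rw [FreeAlgebra.lift_ι_apply, map_one, T_one, map_one]
  | mul x y h =>
    simp only [map_mul, FreeAlgebra.lift_ι_apply]
    rw [T_mul]
    rw [← map_mul, len_shift, len_shift, len_shift, h]
  | quad z s h =>
    obtain ⟨hs, hlt⟩ := mem_desR_iff.1 h
    simp only [map_mul, map_add, map_smul, FreeAlgebra.lift_ι_apply]
    rw [T_quad]
    rw [mem_desR_iff, ← map_mul, len_shift, len_shift]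
    exact ⟨shift_sim hmn i hs, hlt⟩

/-- The homomorphism of Hecke algebras induced by the shift. -/
noncomputable def shiftHom : Hecke m →ₐ[A] Hecke n :=
  RingQuot.liftAlgHom A ⟨FreeAlgebra.lift A fun x => T (shift hmn i x), lift_shift_rel hmn i⟩

theorem shiftHom_T (x : Equiv.Perm (Fin m)) : shiftHom hmn i (T x) = T (shift hmn i x) :=
  (RingQuot.liftAlgHom_mkAlgHom_apply A _ (lift_shift_rel hmn i) (FreeAlgebra.ι A x)).trans
    (FreeAlgebra.lift_ι_apply _ x)

theorem bar_shiftHom (h : Hecke m) :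
    bar n (shiftHom hmn i h) = shiftHom hmn i (bar m h) := by
  have := (span_T (n := m)).ge (Submodule.mem_top (x := h))
  induction this using Submodule.span_induction with
  | mem y hy =>
    obtain ⟨x, rfl⟩ := hy
    rw [shiftHom_T, bar_T, bar_T]
    refine barT_eq ?_
    rw [← map_inv, ← shiftHom_T, ← map_mul, T_mul_barT, map_one]
  | zero => simp
  | add y z _ _ hy hz => simp only [map_add, hy, hz]
  | smul r y _ hy => rw [map_smul, bar_smul, bar_smul, map_smul, hy]

theorem T_mul_shiftHom_T {d : Equiv.Perm (Fin n)} (hd : StrictMono (d ∘ window hmn i))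
    (x : Equiv.Perm (Fin m)) : T d * shiftHom hmn i (T x) = T (d * shift hmn i x) := by
  rw [shiftHom_T, T_mul]
  rw [len_mul_shift hmn i hd, len_shift]

/-- The element `T_d C_y` of the Hecke algebra of `S_n`, where `w = d y` with `d` increasing on the
window and `y` a permutation of the window. -/
noncomputable def mixed (w : Equiv.Perm (Fin n)) : Hecke n :=
  T (rep hmn i w) * shiftHom hmn i (klBasis m (pat hmn i w))

theorem mixed_mul_shift {d : Equiv.Perm (Fin n)} (hd : StrictMono (d ∘ window hmn i))
    (y : Equiv.Perm (Fin m)) :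
    mixed hmn i (d * shift hmn i y) = T d * shiftHom hmn i (klBasis m y) := by
  rw [mixed, rep_mul_shift hmn i hd, pat_mul_shift hmn i hd]

theorem mixed_sub_mem (w : Equiv.Perm (Fin n)) :
    mixed hmn i w - T w ∈ lat vPoly T (fun u => len u < len w) := by
  let f : Hecke m →ₗ[A] Hecke n :=
    (LinearMap.mulLeft A (T (rep hmn i w))).comp (shiftHom hmn i).toLinearMap
  have hf : ∀ y, f (T y) = T (rep hmn i w * shift hmn i y) :=
    T_mul_shiftHom_T hmn i (rep_strictMono hmn i w)
  have h1 : mixed hmn i w - T w = f (klBasis m (pat hmn i w) - T (pat hmn i w)) := by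
    rw [map_sub, hf, rep_mul_shift_pat]
    rfl
  have h2 : lat vPoly T (BruhatLT · (pat hmn i w)) ≤
      (lat vPoly T (fun u => len u < len w)).comap f.toAddMonoidHom :=
    lat_le fun a ha y hy => by
      change f (a • T y) ∈ lat vPoly T (fun u => len u < len w)
      rw [map_smul, hf]
      refine smul_mem_lat ha ?_
      rw [len_mul_shift hmn i (rep_strictMono hmn i w), len_rep_add_len_pat hmn i w]
      exact Nat.add_lt_add_left (len_lt_of_bruhatLT hy) _
  rw [h1]
  exact h2 (klBasis_sub_mem _)

theorem wellFounded_len_lt : WellFounded fun u w : Equiv.Perm (Fin n) => len u < len w :=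
  InvImage.wf len Nat.lt_wfRel.wf

theorem exists_basis_mixed :
    ∃ b : Module.Basis (Equiv.Perm (Fin n)) A (Hecke n), ⇑b = mixed hmn i :=
  exists_basis_of_unitriangular wellFounded_len_lt (fun h h' => lt_trans h h') (basisT n)
    fun w => by rw [coe_basisT]; exact mixed_sub_mem hmn i w

/-- Split `T u` as `T_d` times a shifted `T_y'`. The second factor acts on `C_y` inside the small
algebra, producing only elements above `y` in the left preorder, while `T_d` is carried along. -/
theorem T_mul_shiftHom_klBasis_mem (u : Equiv.Perm (Fin n)) (y : Equiv.Perm (Fin m)) :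
    T u * shiftHom hmn i (klBasis m y) ∈ Submodule.span A
      (mixed hmn i '' {w | rep hmn i w = rep hmn i u ∧ LeftLE y (pat hmn i w)}) := by
  have hd := rep_strictMono hmn i u
  have h1 : T u * shiftHom hmn i (klBasis m y) =
      T (rep hmn i u) * shiftHom hmn i (T (pat hmn i u) * klBasis m y) := by
    rw [map_mul, ← mul_assoc, T_mul_shiftHom_T hmn i hd, rep_mul_shift_pat]
  rw [h1, ← (klBasis m).sum_repr (T (pat hmn i u) * klBasis m y), map_sum, Finset.mul_sum]
  refine sum_mem fun w _ => ?_
  rw [map_smul, mul_smul_comm]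
  by_cases hw : (klBasis m).repr (T (pat hmn i u) * klBasis m y) w = 0
  · rw [hw, zero_smul]; exact zero_mem _
  · refine Submodule.smul_mem _ _ (Submodule.subset_span
      ⟨rep hmn i u * shift hmn i w, ⟨rep_mul_shift hmn i hd w, ?_⟩, mixed_mul_shift hmn i hd w⟩)
    rw [pat_mul_shift hmn i hd]
    exact leftLE_of_repr_ne_zero _ hw

theorem mul_shiftHom_klBasis_mem (h : Hecke n) (y : Equiv.Perm (Fin m)) :
    h * shiftHom hmn i (klBasis m y) ∈
      Submodule.span A (mixed hmn i '' {w | LeftLE y (pat hmn i w)}) := by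
  have := (span_T (n := n)).ge (Submodule.mem_top (x := h))
  induction this using Submodule.span_induction with
  | mem c hc =>
    obtain ⟨u, rfl⟩ := hc
    exact Submodule.span_mono (Set.image_mono fun w hw => hw.2)
      (T_mul_shiftHom_klBasis_mem hmn i u y)
  | zero => simp
  | add c d _ _ hc hd => rw [add_mul]; exact add_mem hc hd
  | smul a c _ hc => rw [smul_mul_assoc]; exact Submodule.smul_mem _ _ hc

/-- The order for which the Kazhdan–Lusztig basis is unitriangular over the elements `T_d C_y`. -/
def MixedLT (u w : Equiv.Perm (Fin n)) : Prop :=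
  len (rep hmn i u) < len (rep hmn i w) ∧ LeftLE (pat hmn i w) (pat hmn i u)

theorem wellFounded_mixedLT : WellFounded (MixedLT hmn i) :=
  Subrelation.wf (fun h => h.1) (InvImage.wf (fun w => len (rep hmn i w)) Nat.lt_wfRel.wf)

theorem MixedLT.trans {u w z : Equiv.Perm (Fin n)} (h : MixedLT hmn i u w)
    (h' : MixedLT hmn i w z) : MixedLT hmn i u z :=
  ⟨h.1.trans h'.1, h'.2.trans h.2⟩

/-- The factor `C_y` is invariant, so only `bar T_d - T_d` contributes. Its terms `T u` have `u`
shorter than `d`, and `rep u` is no longer than `u`. -/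
theorem bar_mixed_sub_mem (w : Equiv.Perm (Fin n)) :
    bar n (mixed hmn i w) - mixed hmn i w ∈ lat ⊤ (mixed hmn i) (MixedLT hmn i · w) := by
  refine span_le_lat ?_
  rw [mixed, map_mul, bar_shiftHom, bar_klBasis, ← sub_mul]
  have h := bar_T_sub_mem (rep hmn i w)
  generalize bar n (T (rep hmn i w)) - T (rep hmn i w) = c at h ⊢
  induction h using Submodule.span_induction with
  | mem c hc =>
    obtain ⟨u, hu, rfl⟩ := hc
    refine Submodule.span_mono (Set.image_mono ?_) (T_mul_shiftHom_klBasis_mem hmn i u _)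
    rintro z ⟨hz, hz'⟩
    refine ⟨?_, hz'⟩
    have h1 := len_rep_add_len_pat hmn i u
    have h2 := len_lt_of_bruhatLT hu
    rw [hz]
    omega
  | zero => simp
  | add c d _ _ hc hd => rw [add_mul]; exact add_mem hc hd
  | smul a c _ hc => rw [smul_mul_assoc]; exact Submodule.smul_mem _ _ hc

/-- The invariant element built from the basis `mixed` is also `T w` plus a `v ℤ[v]`-combination of
standard basis elements, since `mixed` has that form; by uniqueness it is `C_w`. -/
theorem klBasis_sub_mixed_mem (w : Equiv.Perm (Fin n)) :
    klBasis n w - mixed hmn i w ∈ lat vPoly (mixed hmn i) (MixedLT hmn i · w) := by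
  obtain ⟨b, hb⟩ := exists_basis_mixed hmn i
  obtain ⟨c, hc, hc'⟩ := exists_invariant (σ := (bar n).toAddMonoidHom)
    (wellFounded_mixedLT hmn i) (MixedLT.trans hmn i) bar_smul bar_bar b
    (fun w => by rw [hb]; exact bar_mixed_sub_mem hmn i w) w
  rw [hb] at hc'
  rwa [← eq_klBasis (x := w) hc]
  rw [← sub_add_sub_cancel _ (mixed hmn i w)]
  refine add_mem ?_ (lat_mono le_rfl (fun _ _ => trivial) (mixed_sub_mem hmn i w))
  exact lat_le_lat (fun _ _ _ _ => trivial) (fun j _ => mixed_sub_mem hmn i j)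
    (lat_mono le_rfl (P' := fun _ => True) (fun _ _ => trivial) hc')

theorem mixed_sub_klBasis_mem (w : Equiv.Perm (Fin n)) :
    mixed hmn i w - klBasis n w ∈ lat vPoly (klBasis n) (MixedLT hmn i · w) :=
  sub_mem_lat_symm (wellFounded_mixedLT hmn i) (MixedLT.trans hmn i) (klBasis_sub_mixed_mem hmn i) w

/-- Here `d = 1` has length 0, so nothing is below it for `MixedLT` and no correction terms occur.
-/
theorem klBasis_shift (x : Equiv.Perm (Fin m)) :
    klBasis n (shift hmn i x) = shiftHom hmn i (klBasis m x) := by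
  have h1 := klBasis_sub_mixed_mem hmn i (shift hmn i x)
  have h2 : lat vPoly (mixed hmn i) (MixedLT hmn i · (shift hmn i x)) ≤ ⊥ :=
    lat_le fun a _ u hu => by
      have := hu.1
      rw [rep_shift, len_one] at this
      exact absurd this (Nat.not_lt_zero _)
  rw [sub_eq_zero.1 (AddSubgroup.mem_bot.1 (h2 h1)), mixed, rep_shift, pat_shift, T_one, one_mul]

theorem repr_eq_zero_of_mem_lat {ι M : Type*} [AddCommGroup M] [Module A M]
    (b : Module.Basis ι A M) {S : NonUnitalSubring A} {P : ι → Prop} {x : M}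
    (hx : x ∈ lat S b P) {j : ι} (hj : ¬ P j) : b.repr x j = 0 := by
  by_contra h
  exact hj (b.mem_span_image.1 (lat_le_span hx) (Finsupp.mem_support_iff.2 h))

/-- The shift sends distinct Kazhdan–Lusztig elements to distinct ones, so coefficients of a product
survive unchanged. -/
theorem leftLE_shift {x y : Equiv.Perm (Fin m)} (h : LeftLE x y) :
    LeftLE (shift hmn i x) (shift hmn i y) := by
  refine leftLE_iff.2 ((leftLE_iff.1 h).lift _ fun a b => ?_)
  rintro ⟨h, hab⟩
  refine ⟨shiftHom hmn i h, ?_⟩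
  rw [klBasis_shift, ← map_mul, ← (klBasis m).sum_repr (h * klBasis m a), map_sum, map_sum,
    Finsupp.finsetSum_apply, Finset.sum_eq_single b]
  · rwa [map_smul, ← klBasis_shift, map_smul, Module.Basis.repr_self, Finsupp.smul_apply,
      Finsupp.single_eq_same, smul_eq_mul, mul_one]
  · intro c _ hc
    rw [map_smul, ← klBasis_shift, map_smul, Module.Basis.repr_self, Finsupp.smul_apply,
      Finsupp.single_eq_of_ne ((shift_injective hmn i).ne hc.symm), smul_zero]
  · exact fun hb => absurd (Finset.mem_univ b) hb

/-- Multiplying `C_{shift (pat z)}` by `T (rep z)` gives `mixed z`, whose coefficient at `C_z` is 1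
because the correction terms are strictly below `z` for `MixedLT`. -/
theorem shift_pat_leftLE (z : Equiv.Perm (Fin n)) : LeftLE (shift hmn i (pat hmn i z)) z := by
  refine leftLE_of_repr_ne_zero (T (rep hmn i z)) ?_
  rw [klBasis_shift]
  change (klBasis n).repr (mixed hmn i z) z ≠ 0
  have h := repr_eq_zero_of_mem_lat (klBasis n) (mixed_sub_klBasis_mem hmn i z)
    (j := z) fun h => lt_irrefl _ h.1
  rw [map_sub, Finsupp.sub_apply, Module.Basis.repr_self, Finsupp.single_eq_same, sub_eq_zero] at h
  rw [h]
  exact one_ne_zero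

/-- The left order restricts to consecutive patterns. -/
theorem leftLE_pat {x : Equiv.Perm (Fin m)} {z : Equiv.Perm (Fin n)}
    (h : LeftLE (shift hmn i x) z) : LeftLE x (pat hmn i z) := by
  -- The `w` with pattern above `x` form a lower set for `MixedLT`. By triangularity in both
  -- directions, the `mixed` and Kazhdan–Lusztig elements indexed by it have the same span.
  have hlow : ∀ w, LeftLE x (pat hmn i w) → ∀ u, MixedLT hmn i u w → LeftLE x (pat hmn i u) :=
    fun w hw u hu => hw.trans hu.2
  have htop : ∀ a : A, a ∈ vPoly → a ∈ (⊤ : NonUnitalSubring A) :=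
    fun a _ => NonUnitalSubring.mem_top a
  induction leftLE_iff.1 h with
  | refl => rw [pat_shift]; exact LeftLE.refl x
  | @tail a b h1 hab ih =>
    obtain ⟨h, hab⟩ := hab
    have ha := ih (leftLE_iff.2 h1)
    have h2 : klBasis n a ∈ Submodule.span A (mixed hmn i '' {w | LeftLE x (pat hmn i w)}) := by
      refine lat_le_span (S := ⊤) (lat_le_lat hlow (fun w _ =>
        lat_mono htop (fun _ h => h) (klBasis_sub_mixed_mem hmn i w)) ?_)
      rw [← one_smul A (klBasis n a)]
      exact smul_mem_lat (NonUnitalSubring.mem_top _) ha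
    -- This span is a left ideal: `h * mixed w` is some algebra element times the shifted `C_y` with
    -- `y = pat w`, so it only involves patterns above `y`, hence above `x`.
    have h3 : h * klBasis n a ∈
        Submodule.span A (mixed hmn i '' {w | LeftLE x (pat hmn i w)}) := by
      generalize klBasis n a = c at h2 ⊢
      induction h2 using Submodule.span_induction with
      | mem c hc =>
        obtain ⟨w, hw, rfl⟩ := hc
        rw [mixed, ← mul_assoc]
        exact Submodule.span_mono (Set.image_mono fun u hu => LeftLE.trans hw hu)
          (mul_shiftHom_klBasis_mem hmn i _ _)
      | zero => simp
      | add c d _ _ hc hd => rw [mul_add]; exact add_mem hc hd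
      | smul a c _ hc => rw [mul_smul_comm]; exact Submodule.smul_mem _ _ hc
    have h4 : h * klBasis n a ∈ lat ⊤ (klBasis n) (fun w => LeftLE x (pat hmn i w)) :=
      lat_le_lat hlow (fun w _ => lat_mono htop (fun _ h => h) (mixed_sub_klBasis_mem hmn i w))
        (span_le_lat h3)
    by_contra hb
    exact hab (repr_eq_zero_of_mem_lat (klBasis n) h4 hb)

theorem leftLE_iff_of_consecContains {x p : Equiv.Perm (Fin m)} {z : Equiv.Perm (Fin n)}
    (hz : ConsecContains hmn z p i) : LeftLE x p ↔ LeftLE (shift hmn i x) z := by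
  obtain rfl := hz.pat_eq
  exact ⟨fun h => (leftLE_shift hmn i h).trans (shift_pat_leftLE hmn i z), leftLE_pat hmn i⟩

end Parabolic

end KL

theorem proposition3p7 {m n : ℕ} (hmn : m ≤ n) (i : Fin (n - m + 1))
    (x p : Equiv.Perm (Fin m)) (z : Equiv.Perm (Fin n))
    (hz : KL.ConsecContains hmn z p i) :
    (KL.LeftLE x p ↔ KL.LeftLE (KL.shift hmn i x) (KL.shift hmn i p)) ∧
      (KL.LeftLE x p ↔ KL.LeftLE (KL.shift hmn i x) z) :=
  ⟨KL.leftLE_iff_of_consecContains hmn i (KL.consecContains_shift hmn i p),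
    KL.leftLE_iff_of_consecContains hmn i hz⟩
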